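/- **Setting.** Let $G=(V,E)$ be a finite simple undirected planar three-connected graph (it stays connected after the removal of any two vertices) of order $n>4$, and let $\Gamma\subset V$ be the set of vertices of some face of $G$. Let $L_G\in\mathbb{R}^{V\times V}$ be the graph Laplacian of $G$, and write it in blocks with respect to the interior $o=V\setminus\Gamma$ and the boundary $\Gamma$. Let $$S_\Gamma=(L_G)_{\Gamma\Gamma}-(L_G)_{\Gamma o}\,\big((L_G)_{oo}\big)^{-1}(L_G)_{o\Gamma}$$ be the Schur complement with respect to the interior vertices, let $L_\Gamma$ be the Laplacian of the induced subgraph $G[\Gamma]$ (a cycle), and let $L_\Gamma^{1/2}$ be its positive semidefinite square root. For integers $k,\ell$ let $G_{k,\ell}=C_k\,\square\,P_\ell$ be the Cartesian product of the cycle on $k$ vertices and the path on $\ell$ vertices, with vertices $(i,j)$, $1\le i\le k$, $1\le j\le\ell$ (the index $i$ is taken modulo $k$), and let $G^*_{k,\ell}$ be the graph obtained from $G_{k,\ell}$ by adding all edges $\{(i,j),(i-1,j+1)\}$ and $\{(i,j),(i+1,j+1)\}$, $1\le i\le k$, $1\le j\le\ell-1$. A graph $H$ with $G_{k,\ell}\subset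 H\subset G^*_{k,\ell}$ is an *$M$-aggregation* of $(G,\Gamma)$, $M\in\mathbb{N}$, if $V$ is the disjoint union of a (possibly empty) set $a_*$ and sets $a_{i,j}$, $1\le i\le k$, $1\le j\le\ell$, such that 1. $G[a_{i,j}]$ is connected and $|a_{i,j}|\le M$ for all $i,j$; 2. $\Gamma\subset\bigcup_{i=1}^k a_{i,1}$, and $\Gamma\cap a_{i,1}\neq\emptyset$ for all $i$; 3. every neighbor of a vertex of $a_*$ lies in $a_*\cup\bigcup_{i=1}^k a_{i,\ell}$; 4. $(i,j)\mapsto a_{i,j}$ is an isomorphism from $H$ onto the aggregation graph, whose vertices are the sets $a_{i,j}$, two distinct ones being adjacent if and only if some edge of $G$ joins them. **Theorem.** Let $k,\ell,c,M\in\mathbb{N}$ with $\ell\ge 2$ and $4\ell<k<2c\ell$, and suppose that some graph $H$ with $G_{k,\ell}\subset H\subset G^*_{k,\ell}$ is an $M$-aggregation of $(G,\Gamma)$. Then, for every $\varphi\in\mathbb{R}^\Gamma$, $$\frac{1}{36M^2(M+3)\max\{3c,4\pi^2\}\left(\frac{2}{3\pi}+\frac{\sqrt2}{27}\right)}\,\langle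 L_\Gamma^{1/2}\varphi,\varphi\rangle\;\le\;\langle S_\Gamma\varphi,\varphi\rangle\;\le\;\frac{784\,M^4(3c+20)}{\frac{1}{2\pi}-\frac{\sqrt2}{12}}\,\langle L_\Gamma^{1/2}\varphi,\varphi\rangle .$$ In particular, the two constants depend only on $M$ and $c$ and not on $n$. -/

import Mathlib

namespace GraphTrace

open SimpleGraph

/-! ### Planar three-connected graphs with a distinguished face -/

/-- `G` remains connected upon the removal of any set of at most two vertices. -/
def ThreeConnected {V : Type*} (G : SimpleGraph V) : Prop :=
  ∀ s : Finset V, s.card ≤ 2 → (G.induce {v | v ∉ s}).Connected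

/-- A combinatorial embedding (rotation system) of a graph in an oriented surface: for each vertex,
a cyclic ordering of the darts (oriented edges) that leave it, given by the permutation `next`,
whose cycles are exactly the sets of darts with a common origin. -/
structure RotationSystem {V : Type*} (G : SimpleGraph V) where
  /-- the dart that follows a given one in the cyclic order around their common origin -/
  next : Equiv.Perm G.Dart
  next_fst : ∀ d : G.Dart, (next d).fst = d.fst
  sameCycle_of_fst_eq : ∀ d d' : G.Dart, d.fst = d'.fst → next.SameCycle d d'

namespace RotationSystem

variable {V : Type*} {G : SimpleGraph V} (R : RotationSystem G)

/-- Face tracing: traverse the dart `d`, then leave its endpoint by the dart that follows the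
reversal of `d`. The orbits of this permutation are the boundary walks of the faces. -/
def faceStep : Equiv.Perm G.Dart :=
  (Dart.symm_involutive (G := G)).toPerm.trans R.next

/-- The faces of the embedding: the orbits of the face tracing permutation. -/
def Face : Type _ := Quotient (Equiv.Perm.SameCycle.setoid R.faceStep)

/-- The vertices of the face whose boundary walk contains the dart `d`. -/
def faceVertices (d : G.Dart) : Set V :=
  {v | ∃ d' : G.Dart, R.faceStep.SameCycle d d' ∧ d'.fst = v}

/-- Euler's formula `|V| - |E| + |F| = 2`: for a finite connected graph with at least one edge, the
surface of the rotation system is the sphere, so that the embedding is a planar one. -/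
def IsPlanar : Prop :=
  (Nat.card V : ℤ) - (Nat.card G.edgeSet : ℤ) + (Nat.card R.Face : ℤ) = 2

end RotationSystem

/-- `(G, Γ)` belongs to the class of pairs of a planar three-connected simple graph of order greater
than four and the vertex set of one of its faces. -/
structure IsPlanarPair {V : Type*} (G : SimpleGraph V) (Γ : Set V) : Prop where
  four_lt_card : 4 < Nat.card V
  threeConnected : ThreeConnected G
  exists_face : ∃ R : RotationSystem G, R.IsPlanar ∧ ∃ d : G.Dart, Γ = R.faceVertices d

/-! ### The graphs `G_{k,ℓ}`, `G*_{k,ℓ}` and aggregations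

The vertex `(i, j)`, `1 ≤ i ≤ k`, `1 ≤ j ≤ ℓ`, is represented by `(i - 1, j - 1) : Fin k × Fin ℓ`. -/

/-- `G_{k,ℓ}`, the Cartesian product of the `k`-cycle and the path on `ℓ` vertices. -/
def annulus (k ℓ : ℕ) : SimpleGraph (Fin k × Fin ℓ) :=
  cycleGraph k □ pathGraph ℓ

/-- `G*_{k,ℓ}`: the graph `G_{k,ℓ}` with the diagonals `{(i, j), (i - 1, j + 1)}` and
`{(i, j), (i + 1, j + 1)}` (first coordinate modulo `k`) of all its squares added. -/
def annulusStar (k ℓ : ℕ) : SimpleGraph (Fin k × Fin ℓ) :=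
  annulus k ℓ ⊔ SimpleGraph.fromRel fun x y =>
    (cycleGraph k).Adj x.1 y.1 ∧ (y.2 : ℕ) = (x.2 : ℕ) + 1

/-- The aggregation graph of a family of vertex sets: two distinct members are adjacent if some
edge of `G` joins them. -/
def aggregationGraph {V ι : Type*} (G : SimpleGraph V) (a : ι → Set V) : SimpleGraph ι where
  Adj x y := x ≠ y ∧ ∃ p ∈ a x, ∃ q ∈ a y, G.Adj p q
  symm := by
    constructor
    rintro x y ⟨hne, p, hp, q, hq, h⟩
    exact ⟨hne.symm, q, hq, p, hp, h.symm⟩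
  loopless := by
    constructor
    rintro x ⟨hne, -⟩
    exact hne rfl

/-- The sets `aStar` and `a (i, j)` form a partition of the vertex set of `G` that exhibits `H` as an
`M`-aggregation of `(G, Γ)`; the aggregate `a (i, j)` corresponds to the vertex `(i, j)` of `H`. -/
structure IsAggregationPartition {V : Type*} (M : ℕ) (G : SimpleGraph V) (Γ : Set V) {k ℓ : ℕ}
    (H : SimpleGraph (Fin k × Fin ℓ)) (aStar : Set V) (a : Fin k × Fin ℓ → Set V) : Prop where
  union_eq : aStar ∪ ⋃ x, a x = Set.univ
  disjoint_star : ∀ x, Disjoint aStar (a x)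
  disjoint : ∀ x y, x ≠ y → Disjoint (a x) (a y)
  connected : ∀ x, (G.induce (a x)).Connected
  ncard_le : ∀ x, (a x).ncard ≤ M
  boundary_subset : ∀ p ∈ Γ, ∃ x : Fin k × Fin ℓ, (x.2 : ℕ) = 0 ∧ p ∈ a x
  boundary_inter : ∀ x : Fin k × Fin ℓ, (x.2 : ℕ) = 0 → (Γ ∩ a x).Nonempty
  star_neighbors : ∀ p ∈ aStar, ∀ q, G.Adj p q →
    q ∈ aStar ∨ ∃ x : Fin k × Fin ℓ, (x.2 : ℕ) + 1 = ℓ ∧ q ∈ a x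
  aggregationGraph_eq : aggregationGraph G a = H

/-- `H` is an `M`-aggregation of `(G, Γ)`. -/
def IsAggregation {V : Type*} (M : ℕ) (G : SimpleGraph V) (Γ : Set V) {k ℓ : ℕ}
    (H : SimpleGraph (Fin k × Fin ℓ)) : Prop :=
  ∃ (aStar : Set V) (a : Fin k × Fin ℓ → Set V), IsAggregationPartition M G Γ H aStar a

/-! ### The Schur complement and the square root of the boundary Laplacian -/

noncomputable section

open Classical in
/-- The Schur complement `S_Γ` of the graph Laplacian of `G` with respect to the interior vertices
`V \ Γ`, that is, `L_ΓΓ - L_Γo (L_oo)⁻¹ L_oΓ` where `o = V \ Γ`. -/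
def schurComplement {V : Type*} [Fintype V] (G : SimpleGraph V) (Γ : Set V) : Matrix Γ Γ ℝ :=
  let L : Matrix V V ℝ := G.lapMatrix ℝ
  L.toBlock (· ∈ Γ) (· ∈ Γ) -
    L.toBlock (· ∈ Γ) (· ∉ Γ) * (L.toBlock (· ∉ Γ) (· ∉ Γ))⁻¹ * L.toBlock (· ∉ Γ) (· ∈ Γ)

open Classical in
/-- `L_Γ^{1/2}`: the positive semidefinite square root (through the functional calculus of
Hermitian matrices) of the Laplacian `L_Γ` of the induced subgraph `G[Γ]`. -/
def sqrtBoundaryLaplacian {V : Type*} [Fintype V] (G : SimpleGraph V) (Γ : Set V) :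
    Matrix Γ Γ ℝ :=
  cfc Real.sqrt ((G.induce Γ).lapMatrix ℝ)

open Classical in
/-- The quadratic form `⟨A φ, φ⟩` of a matrix. -/
def quadForm {V : Type*} [Fintype V] {Γ : Set V} (A : Matrix Γ Γ ℝ) (φ : Γ → ℝ) : ℝ :=
  A.mulVec φ ⬝ᵥ φ

end

end GraphTrace

/-!
The quadratic form of `S_Γ` is the minimal energy of the extensions of `φ` to `V`.

For the lower bound, let `u` be the extension of minimal energy, pick one vertex of every aggregate,
and let `x j` be the values of `u` in row `j`. Between consecutive rows `⟨√L x, x⟩` changes by at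
most the energy of `u` near these rows, and some row has energy at most `1 / ℓ` of the total; there
the form is controlled since `k ≤ 2 c ℓ`.

For the upper bound, extend `φ` row by row by the descent `x ↦ x - τ √L x`, whose energies sum to at
most a multiple of `⟨√L φ, φ⟩`, and flatten it to the mean of `φ` by a linear cutoff; the spectral
gap of the boundary pays for the cutoff. Here the part of `Γ` in two consecutive columns has to be
connected. Planarity gives this: if two disjoint connected sets cover a face, Euler's formula leaves
no cut that separates its boundary walk more than once.
-/

namespace GraphTrace

open SimpleGraph Matrix
open scoped Classical

theorem eq_of_preconnected {V α : Type*} {G : SimpleGraph V} (hG : G.Preconnected) {f : V → α}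
    (hf : ∀ u v, G.Adj u v → f u = f v) (u v : V) : f u = f v := by
  have huv := (reachable_iff_reflTransGen u v).1 (hG u v)
  induction huv with
  | refl => rfl
  | tail _ hadj ih => exact ih.trans (hf _ _ hadj)

theorem finrank_le_one_of_forall_eq {ι : Type*} (S : Submodule ℝ (ι → ℝ))
    (hS : ∀ f ∈ S, ∀ i j, f i = f j) : Module.finrank ℝ S ≤ 1 := by
  have hspan : S ≤ Submodule.span ℝ {1} := by
    intro f hf
    rw [Submodule.mem_span_singleton]
    rcases isEmpty_or_nonempty ι with _ | ⟨⟨i⟩⟩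
    · exact ⟨0, Subsingleton.elim _ _⟩
    · exact ⟨f i, funext fun j => by simp [hS f hf i j]⟩
  exact (Submodule.finrank_mono hspan).trans ((finrank_span_le_card _).trans (by simp))

section Flows

variable {V : Type*} {G : SimpleGraph V}

instance [Finite V] : Finite G.Dart :=
  have := Fintype.ofFinite V
  inferInstance

/-- The flows on `G`: antisymmetric functions on the darts. -/
def flows (G : SimpleGraph V) : Submodule ℝ (G.Dart → ℝ) where
  carrier := {z | ∀ d, z d.symm = -z d}
  add_mem' hz hw d := by simp [hz d, hw d, add_comm]
  zero_mem' _ := by simp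
  smul_mem' c z hz d := by simp [hz d]

/-- The flow induced by a potential on the vertices. -/
noncomputable def gradient : (V → ℝ) →ₗ[ℝ] G.Dart → ℝ :=
  LinearMap.funLeft ℝ ℝ (·.fst) - LinearMap.funLeft ℝ ℝ (·.snd)

theorem gradient_apply (g : V → ℝ) (d : G.Dart) : gradient g d = g d.fst - g d.snd := rfl

theorem gradient_mem_flows (g : V → ℝ) : gradient g ∈ flows G := fun d => by
  simp [gradient_apply]

section Fintype

variable [Fintype V]

/-- The net amount of a flow that leaves each vertex. -/
noncomputable def divergence : (G.Dart → ℝ) →ₗ[ℝ] V → ℝ :=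
  ∑ d : G.Dart, LinearMap.single ℝ (fun _ => ℝ) d.fst ∘ₗ LinearMap.proj d

theorem divergence_apply (z : G.Dart → ℝ) : divergence z = ∑ d, Pi.single d.fst (z d) := by
  simp [divergence]

theorem divergence_single (e : G.Dart) :
    divergence (Pi.single e (1 : ℝ)) = Pi.single e.fst 1 := by
  rw [divergence_apply, Finset.sum_eq_single_of_mem e (Finset.mem_univ e)]
  · simp
  · intro d _ hd
    simp [hd]

theorem dotProduct_divergence (g : V → ℝ) (z : G.Dart → ℝ) :
    g ⬝ᵥ divergence z = ∑ d : G.Dart, g d.fst * z d := by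
  simp [divergence_apply, dotProduct_sum]

theorem dotProduct_gradient {z : G.Dart → ℝ} (hz : z ∈ flows G) (g : V → ℝ) :
    z ⬝ᵥ gradient g = 2 * (g ⬝ᵥ divergence z) := by
  have hsnd : ∑ d : G.Dart, z d * g d.snd = -∑ d : G.Dart, z d * g d.fst := by
    rw [← Equiv.sum_comp (Dart.symm_involutive (G := G)).toPerm, ← Finset.sum_neg_distrib]
    exact Finset.sum_congr rfl fun d _ => by simp [hz d]
  rw [dotProduct_divergence]
  simp only [dotProduct, gradient_apply, mul_sub, Finset.sum_sub_distrib, hsnd, mul_comm (g _)]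
  ring

theorem gradient_eq_zero_of_divergence_eq_zero {g : V → ℝ}
    (hdiv : divergence (gradient (G := G) g) = 0) : gradient (G := G) g = 0 := by
  rw [← dotProduct_self_eq_zero, dotProduct_gradient (gradient_mem_flows g), hdiv]
  simp

theorem exists_unit_flow {A : Set V} (hA : (G.induce A).Preconnected) {p q : V} (hp : p ∈ A)
    (hq : q ∈ A) :
    ∃ P ∈ flows G, (∀ d, d.fst ∉ A → P d = 0) ∧ divergence P = Pi.single p 1 - Pi.single q 1 := by
  lift p to A using hp
  lift q to A using hq
  obtain ⟨w⟩ := hA p q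
  induction w with
  | nil => exact ⟨0, zero_mem _, by simp, by simp⟩
  | @cons a b c hab _ ih =>
    obtain ⟨P, hflow, hsupp, hdiv⟩ := ih
    let e : G.Dart := ⟨(a.1, b.1), hab⟩
    refine ⟨Pi.single e 1 - Pi.single e.symm 1 + P,
      add_mem (fun d => ?_) hflow, fun d hd => ?_, ?_⟩
    · have h₁ : d.symm = e ↔ d = e.symm := (Dart.symm_involutive (G := G)).eq_iff
      have h₂ : d.symm = e.symm ↔ d = e := (Dart.symm_involutive (G := G)).injective.eq_iff
      simp [Pi.single_apply, h₁, h₂]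
    · have h₁ : d ≠ e := by rintro rfl; exact hd a.2
      have h₂ : d ≠ e.symm := by rintro rfl; exact hd b.2
      simp [h₁, h₂, hsupp d hd]
    · rw [map_add, map_sub, divergence_single, divergence_single, hdiv]
      exact sub_add_sub_cancel _ _ _

end Fintype

section Finite

variable [Finite V]

theorem finrank_flows_le : Module.finrank ℝ (flows G) ≤ Nat.card G.edgeSet := by
  have := Fintype.ofFinite V
  have hdart : ∀ e : G.edgeSet, ∃ d : G.Dart, d.edge = e := by
    rintro ⟨⟨u, v⟩, h⟩
    exact ⟨⟨(u, v), h⟩, rfl⟩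
  choose dart hdart using hdart
  let restrict : flows G →ₗ[ℝ] G.edgeSet → ℝ :=
    LinearMap.funLeft ℝ ℝ dart ∘ₗ (flows G).subtype
  have hinj : Function.Injective restrict := by
    rw [← LinearMap.ker_eq_bot, LinearMap.ker_eq_bot']
    rintro ⟨z, hz⟩ hzero
    ext d
    have hd : z (dart ⟨d.edge, d.edge_mem⟩) = 0 := congrFun hzero _
    obtain h | h := dart_edge_eq_iff _ _ |>.1 (hdart ⟨d.edge, d.edge_mem⟩)
    · simpa [h] using hd
    · simpa [h, hz d] using hd
  simpa using LinearMap.finrank_le_finrank_of_injective hinj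

theorem finrank_range_gradient_ge (hG : G.Preconnected) :
    Nat.card V ≤ Module.finrank ℝ (LinearMap.range (gradient (G := G))) + 1 := by
  have := Fintype.ofFinite V
  have hker : Module.finrank ℝ (LinearMap.ker (gradient (G := G))) ≤ 1 :=
    finrank_le_one_of_forall_eq _ fun g hg =>
      eq_of_preconnected hG fun u v huv =>
        sub_eq_zero.1 (congrFun (LinearMap.mem_ker.1 hg) ⟨(u, v), huv⟩)
  have hrank := LinearMap.finrank_range_add_finrank_ker (gradient (G := G))
  rw [Module.finrank_fintype_fun_eq_card, ← Nat.card_eq_fintype_card] at hrank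
  lia

end Finite

end Flows

namespace RotationSystem

variable {V : Type*} {G : SimpleGraph V} (R : RotationSystem G)

theorem faceStep_fst (d : G.Dart) : (R.faceStep d).fst = d.snd :=
  R.next_fst d.symm

/-- The face on whose boundary walk a dart lies. -/
def faceOf (d : G.Dart) : R.Face := Quotient.mk _ d

theorem faceOf_faceStep (d : G.Dart) : R.faceOf (R.faceStep d) = R.faceOf d :=
  Quotient.sound (Equiv.Perm.SameCycle.refl _ _).apply_left

theorem faceOf_faceStep_symm (d : G.Dart) : R.faceOf (R.faceStep.symm d) = R.faceOf d := by
  rw [← R.faceOf_faceStep, Equiv.apply_symm_apply]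

theorem faceStep_symm_next (d : G.Dart) : R.faceStep.symm (R.next d) = d.symm := by
  rw [Equiv.symm_apply_eq]
  exact congrArg R.next d.symm_symm.symm

theorem faceOf_next (d : G.Dart) : R.faceOf (R.next d) = R.faceOf d.symm := by
  rw [← R.faceStep_symm_next, R.faceOf_faceStep_symm]

/-- The flow that circulates around each face with the given intensity. -/
def faceGradient : (R.Face → ℝ) →ₗ[ℝ] G.Dart → ℝ :=
  LinearMap.funLeft ℝ ℝ R.faceOf - LinearMap.funLeft ℝ ℝ (R.faceOf ∘ Dart.symm)

theorem faceGradient_apply (h : R.Face → ℝ) (d : G.Dart) :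
    R.faceGradient h d = h (R.faceOf d) - h (R.faceOf d.symm) := rfl

theorem faceGradient_mem_flows (h : R.Face → ℝ) : R.faceGradient h ∈ flows G := fun d => by
  simp [faceGradient_apply]

theorem eq_of_fst_eq [Finite V] {α : Type*} {f : G.Dart → α} {d d' : G.Dart} (h : d.fst = d'.fst)
    (hnext : ∀ e, e.fst = d.fst → f (R.next e) = f e) : f d = f d' := by
  obtain ⟨n, rfl⟩ := (R.sameCycle_of_fst_eq d d' h).exists_nat_pow_eq
  suffices hn : ((R.next ^ n) d).fst = d.fst ∧ f d = f ((R.next ^ n) d) from hn.2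
  clear h
  induction n with
  | zero => exact ⟨rfl, rfl⟩
  | succ n ih =>
    rw [pow_succ', Equiv.Perm.mul_apply, R.next_fst, hnext _ ih.1]
    exact ih

theorem eq_of_preconnected_induce [Finite V] {A : Set V} (hA : (G.induce A).Preconnected)
    {α : Type*} {f : G.Dart → α} (hnext : ∀ d, d.fst ∈ A → f (R.next d) = f d)
    (hsymm : ∀ d, d.fst ∈ A → f d.symm = f d) {d d' : G.Dart} (hd : d.fst ∈ A)
    (hd' : d'.fst ∈ A) : f d = f d' := by
  have hvert {e e' : G.Dart} (he : e.fst ∈ A) (h : e.fst = e'.fst) : f e = f e' :=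
    R.eq_of_fst_eq h fun x hx => hnext x (hx ▸ he)
  have hwalk (p q : A) (w : (G.induce A).Walk p q) :
      ∀ e e' : G.Dart, e.fst = p → e'.fst = q → f e = f e' := by
    induction w with
    | nil => exact fun e e' he he' => hvert (he ▸ Subtype.prop _) (he.trans he'.symm)
    | @cons a b c hab _ ih =>
      intro e e' he he'
      rw [hvert (e' := ⟨(a, b), hab⟩) (he ▸ a.2) he, ← hsymm _ a.2]
      exact ih _ _ rfl he'
  obtain ⟨w⟩ := hA ⟨_, hd⟩ ⟨_, hd'⟩
  exact hwalk _ _ w d d' rfl rfl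

section Fintype

variable [Fintype V]

theorem divergence_comp_next (z : G.Dart → ℝ) : divergence (z ∘ R.next) = divergence z := by
  rw [divergence_apply, divergence_apply,
    ← Equiv.sum_comp R.next fun d => Pi.single (M := fun _ => ℝ) d.fst (z d)]
  simp only [Function.comp_apply, R.next_fst]

theorem divergence_sub_comp_symm (z : G.Dart → ℝ) :
    divergence (z - z ∘ Dart.symm) = divergence (z - z ∘ R.faceStep.symm) := by
  rw [map_sub, map_sub, ← R.divergence_comp_next (z ∘ R.faceStep.symm)]
  simp only [Function.comp_def, R.faceStep_symm_next]

theorem divergence_faceGradient (h : R.Face → ℝ) : divergence (R.faceGradient h) = 0 := by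
  have hface : (h ∘ R.faceOf) ∘ R.faceStep.symm = h ∘ R.faceOf :=
    funext fun d => congrArg h (R.faceOf_faceStep_symm d)
  rw [show R.faceGradient h = h ∘ R.faceOf - (h ∘ R.faceOf) ∘ Dart.symm from rfl,
    R.divergence_sub_comp_symm, hface, sub_self, map_zero]

end Fintype

section Finite

variable [Finite V]

theorem disjoint_range_gradient_range_faceGradient :
    Disjoint (LinearMap.range (gradient (G := G))) (LinearMap.range R.faceGradient) := by
  have := Fintype.ofFinite V
  rw [Submodule.disjoint_def]
  rintro _ ⟨g, rfl⟩ ⟨h, hh⟩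
  exact gradient_eq_zero_of_divergence_eq_zero (hh ▸ R.divergence_faceGradient h)

instance : Finite R.Face :=
  Quotient.finite _

theorem finrank_range_faceGradient_ge (hG : G.Preconnected) :
    Nat.card R.Face ≤ Module.finrank ℝ (LinearMap.range R.faceGradient) + 1 := by
  let _ := Fintype.ofFinite R.Face
  have hker : Module.finrank ℝ (LinearMap.ker R.faceGradient) ≤ 1 := by
    refine finrank_le_one_of_forall_eq _ fun h hh x y => ?_
    induction x using Quotient.inductionOn with | h d =>
    induction y using Quotient.inductionOn with | h d' =>
    have hsymm (e : G.Dart) : h (R.faceOf e.symm) = h (R.faceOf e) :=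
      (sub_eq_zero.1 (congrFun hh e)).symm
    exact R.eq_of_preconnected_induce (A := Set.univ) (f := fun e => h (R.faceOf e))
      (induceUnivIso G |>.preconnected_iff.2 hG) (fun e _ => by rw [R.faceOf_next, hsymm])
      (fun e _ => hsymm e) trivial trivial
  have hrank := LinearMap.finrank_range_add_finrank_ker R.faceGradient
  rw [Module.finrank_fintype_fun_eq_card, ← Nat.card_eq_fintype_card] at hrank
  lia

/- By Euler's formula the dimensions of the two ranges add up to at least the number of edges. -/
theorem range_gradient_sup_range_faceGradient (hG : G.Preconnected) (hR : R.IsPlanar) :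
    LinearMap.range gradient ⊔ LinearMap.range R.faceGradient = flows G := by
  refine Submodule.eq_of_le_of_finrank_le (sup_le ?_ ?_) ?_
  · rintro _ ⟨g, rfl⟩
    exact gradient_mem_flows g
  · rintro _ ⟨h, rfl⟩
    exact R.faceGradient_mem_flows h
  · have hsup := Submodule.finrank_sup_add_finrank_inf_eq
      (LinearMap.range (gradient (G := G))) (LinearMap.range R.faceGradient)
    rw [R.disjoint_range_gradient_range_faceGradient.eq_bot, finrank_bot] at hsup
    have hflows := finrank_flows_le (G := G)
    have hgrad := finrank_range_gradient_ge hG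
    have hface := R.finrank_range_faceGradient_ge hG
    unfold IsPlanar at hR
    lia

end Finite

theorem exists_faceGradient_eq [Fintype V] (hG : G.Preconnected) (hR : R.IsPlanar) {z : G.Dart → ℝ}
    (hz : z ∈ flows G) (hdiv : divergence z = 0) : ∃ h, R.faceGradient h = z := by
  rw [← R.range_gradient_sup_range_faceGradient hG hR, Submodule.mem_sup] at hz
  obtain ⟨_, ⟨g, rfl⟩, _, ⟨h, rfl⟩, rfl⟩ := hz
  rw [map_add, R.divergence_faceGradient, add_zero] at hdiv
  exact ⟨h, by rw [gradient_eq_zero_of_divergence_eq_zero hdiv, zero_add]⟩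

/-- The indicator function of the first `n` darts of the boundary walk that starts with `x`, counted
with multiplicity. -/
noncomputable def arc (x : G.Dart) (n : ℕ) : G.Dart → ℝ :=
  ∑ i ∈ Finset.range n, Pi.single (R.faceStep^[i] x) 1

theorem arc_sub_comp_symm (x : G.Dart) (n : ℕ) :
    R.arc x n - R.arc x n ∘ R.faceStep.symm =
      Pi.single x 1 - Pi.single (R.faceStep^[n] x) 1 := by
  have hshift : R.arc x n ∘ R.faceStep.symm =
      ∑ i ∈ Finset.range n, Pi.single (R.faceStep^[i + 1] x) 1 := by
    ext d
    simp [arc, Pi.single_apply, Function.iterate_succ_apply', Equiv.symm_apply_eq]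
  rw [hshift, arc, ← Finset.sum_sub_distrib]
  exact Finset.sum_range_sub' (fun i => (Pi.single (R.faceStep^[i] x) 1 : G.Dart → ℝ)) n

theorem arc_iterate {x : G.Dart} {n i : ℕ} (hn : n ≤ Function.minimalPeriod R.faceStep x)
    (hi : i < Function.minimalPeriod R.faceStep x) :
    R.arc x n (R.faceStep^[i] x) = if i < n then 1 else 0 := by
  have hinj {j : ℕ} (hj : j < n) : R.faceStep^[i] x = R.faceStep^[j] x ↔ i = j :=
    (Function.iterate_injOn_Iio_minimalPeriod.eq_iff hi (hj.trans_le hn))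
  rw [arc, Finset.sum_apply, Finset.sum_congr rfl fun j hj => by
    rw [Pi.single_apply, if_congr (hinj (Finset.mem_range.1 hj)) rfl rfl]]
  simp

/- Closing the jumps of `a` up by a flow inside `A` yields a circulation, hence the boundary of a
function `h` on the faces; then `h - a` does not change along the darts that leave `A'`. -/
theorem eq_of_sub_comp_faceStep_symm [Finite V] (hG : G.Preconnected) (hR : R.IsPlanar)
    {A A' : Set V} (hA : (G.induce A).Preconnected) (hA' : (G.induce A').Preconnected)
    (hdisj : Disjoint A A') {a : G.Dart → ℝ} {p q x y : G.Dart} (hp : p.fst ∈ A) (hq : q.fst ∈ A)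
    (ha : a - a ∘ R.faceStep.symm = Pi.single p 1 - Pi.single q 1)
    (hx : x.fst ∈ A') (hy : y.fst ∈ A') (hxy : R.faceOf x = R.faceOf y) : a x = a y := by
  have := Fintype.ofFinite V
  have hoff {d : G.Dart} (hd : d.fst ∈ A') : d.fst ∉ A := hdisj.notMem_of_mem_right hd
  obtain ⟨P, hPflow, hPsupp, hPdiv⟩ := exists_unit_flow hA hq hp
  have hz : a - a ∘ Dart.symm + P ∈ flows G := by
    refine add_mem (fun d => ?_) hPflow
    simp
  obtain ⟨h, hh⟩ := R.exists_faceGradient_eq hG hR hz <| by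
    rw [map_add, R.divergence_sub_comp_symm, ha, map_sub, divergence_single, divergence_single,
      hPdiv, sub_add_sub_cancel', sub_self]
  have hsymm {d : G.Dart} (hd : d.fst ∈ A') :
      h (R.faceOf d.symm) - a d.symm = h (R.faceOf d) - a d := by
    have hd' := congrFun hh d
    simp only [faceGradient_apply, Pi.add_apply, Pi.sub_apply, Function.comp_apply,
      hPsupp d (hoff hd)] at hd'
    linarith
  have hnext {d : G.Dart} (hd : d.fst ∈ A') : a (R.next d) = a d.symm := by
    have hne {e : G.Dart} (he : e.fst ∈ A) : R.next d ≠ e := by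
      rintro rfl
      exact hoff hd (R.next_fst d ▸ he)
    have hd' := congrFun ha (R.next d)
    simpa [R.faceStep_symm_next, hne hp, hne hq, sub_eq_zero] using hd'
  have hconst := R.eq_of_preconnected_induce hA' (f := fun d => h (R.faceOf d) - a d)
    (fun d hd => by rw [R.faceOf_next, hnext hd, hsymm hd]) (fun d hd => hsymm hd) hx hy
  simpa [hxy] using hconst

theorem reachable_induce_iterate {B : Set V} {x : G.Dart} {n : ℕ}
    (h : ∀ i ≤ n, (R.faceStep^[i] x).fst ∈ B) :
    (G.induce B).Reachable ⟨x.fst, h 0 n.zero_le⟩ ⟨(R.faceStep^[n] x).fst, h n le_rfl⟩ := by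
  induction n with
  | zero => rfl
  | succ n ih =>
    refine (ih fun i hi => h i (hi.trans n.le_succ)).trans (Adj.reachable ?_)
    simp [Function.iterate_succ_apply', R.faceStep_fst]

theorem iterate_fst_mem_faceVertices {d x : G.Dart} (hx : R.faceStep.SameCycle d x) (i : ℕ) :
    (R.faceStep^[i] x).fst ∈ R.faceVertices d :=
  ⟨_, hx.trans ⟨i, by rw [zpow_natCast, ← Equiv.Perm.iterate_eq_pow]⟩, rfl⟩

theorem faceOf_iterate (x : G.Dart) (i : ℕ) : R.faceOf (R.faceStep^[i] x) = R.faceOf x := by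
  induction i with
  | zero => rfl
  | succ i ih => rw [Function.iterate_succ_apply', R.faceOf_faceStep, ih]

theorem exists_iterate_eq_of_sameCycle [Finite V] {x y : G.Dart} (h : R.faceStep.SameCycle x y) :
    ∃ n < Function.minimalPeriod R.faceStep x, R.faceStep^[n] x = y := by
  obtain ⟨n, rfl⟩ := h.exists_nat_pow_eq
  refine ⟨n % _, Nat.mod_lt _ ?_, ?_⟩
  · exact Function.minimalPeriod_pos_of_mem_periodicPts
      (R.faceStep.injective.mem_periodicPts x)
  · rw [Function.iterate_mod_minimalPeriod_eq, Equiv.Perm.iterate_eq_pow]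

/- The boundary walk leads from one vertex of `A` to another in two ways. If both met `A'`, then the
indicator function of the first one would take two values on `A'`. -/
theorem preconnected_faceVertices_inter [Finite V] (hG : G.Preconnected) (hR : R.IsPlanar)
    {A A' : Set V} (hA : (G.induce A).Preconnected) (hA' : (G.induce A').Preconnected)
    (hdisj : Disjoint A A') {d : G.Dart} (hcover : R.faceVertices d ⊆ A ∪ A') :
    (G.induce (R.faceVertices d ∩ A)).Preconnected := by
  rintro ⟨_, ⟨x, hx, rfl⟩, hxA⟩ ⟨_, ⟨y, hy, rfl⟩, hyA⟩
  obtain ⟨n, hn, rfl⟩ := R.exists_iterate_eq_of_sameCycle (hx.symm.trans hy)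
  set N := Function.minimalPeriod R.faceStep x
  have hface (i : ℕ) : (R.faceStep^[i] x).fst ∈ R.faceVertices d :=
    R.iterate_fst_mem_faceVertices hx i
  by_cases hfwd : ∀ i ≤ n, (R.faceStep^[i] x).fst ∈ A
  · have hmem : ∀ i ≤ n, (R.faceStep^[i] x).fst ∈ R.faceVertices d ∩ A :=
      fun i hi => ⟨hface i, hfwd i hi⟩
    exact R.reachable_induce_iterate hmem
  by_cases hbwd : ∀ i ≤ N - n, (R.faceStep^[i] (R.faceStep^[n] x)).fst ∈ A
  · have hclosed : R.faceStep^[N - n] (R.faceStep^[n] x) = x := by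
      rw [← Function.iterate_add_apply, Nat.sub_add_cancel hn.le, Function.iterate_minimalPeriod]
    have hmem : ∀ i ≤ N - n,
        (R.faceStep^[i] (R.faceStep^[n] x)).fst ∈ R.faceVertices d ∩ A :=
      fun i hi => ⟨R.iterate_fst_mem_faceVertices hy i, hbwd i hi⟩
    have hreach := R.reachable_induce_iterate hmem
    simp only [hclosed] at hreach
    exact hreach.symm
  push Not at hfwd hbwd
  obtain ⟨i, hi, hiA⟩ := hfwd
  obtain ⟨j, hj, hjA⟩ := hbwd
  rw [← Function.iterate_add_apply] at hjA
  have hin : i < n := hi.lt_of_ne (by rintro rfl; exact hiA hyA)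
  have hjn : j + n < N := by
    refine lt_of_le_of_ne (by lia) fun hjN => hjA ?_
    rw [hjN, Function.iterate_minimalPeriod]
    exact hxA
  have harc := R.eq_of_sub_comp_faceStep_symm hG hR hA hA' hdisj hxA hyA (R.arc_sub_comp_symm x n)
    ((hcover (hface i)).resolve_left hiA) ((hcover (hface (j + n))).resolve_left hjA)
    (by rw [R.faceOf_iterate, R.faceOf_iterate])
  rw [R.arc_iterate hn.le (hin.trans hn), R.arc_iterate hn.le hjn] at harc
  simp [hin] at harc

end RotationSystem

section QuadraticForms

variable {W : Type*} [Fintype W] {B : Matrix W W ℝ}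

theorem two_mul_dotProduct_le (x y : W → ℝ) (s : ℝ) :
    2 * s * (x ⬝ᵥ y) ≤ x ⬝ᵥ x + s ^ 2 * (y ⬝ᵥ y) := by
  have h := dotProduct_star_self_nonneg (x - s • y)
  simp only [star_trivial, sub_dotProduct, dotProduct_sub, smul_dotProduct, dotProduct_smul,
    smul_eq_mul, dotProduct_comm y x] at h
  linarith

theorem dotProduct_le_mul {x y : W → ℝ} {r e : ℝ} (hr : 0 < r) (hx : x ⬝ᵥ x ≤ r ^ 2 * e)
    (hy : y ⬝ᵥ y ≤ e) : x ⬝ᵥ y ≤ r * e := by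
  have hyoung := two_mul_dotProduct_le x y r
  have hy := mul_le_mul_of_nonneg_left hy (sq_nonneg r)
  exact le_of_mul_le_mul_left (by linarith) hr

theorem mulVec_dotProduct_comm (hB : B.IsHermitian) (x y : W → ℝ) :
    B *ᵥ x ⬝ᵥ y = B *ᵥ y ⬝ᵥ x := by
  rw [dotProduct_comm, dotProduct_mulVec, ← mulVec_transpose,
    ← conjTranspose_eq_transpose_of_trivial, hB.eq]

theorem mulVec_dotProduct_self_nonneg (hB : B.PosSemidef) (x : W → ℝ) : 0 ≤ B *ᵥ x ⬝ᵥ x := by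
  have h := hB.dotProduct_mulVec_nonneg x
  rwa [star_trivial, dotProduct_comm] at h

theorem mulVec_sub_smul_dotProduct_self (hB : B.IsHermitian) (x y : W → ℝ) (s : ℝ) :
    B *ᵥ (x - s • y) ⬝ᵥ (x - s • y) =
      B *ᵥ x ⬝ᵥ x - 2 * s * (B *ᵥ x ⬝ᵥ y) + s ^ 2 * (B *ᵥ y ⬝ᵥ y) := by
  simp only [mulVec_sub, mulVec_smul, sub_dotProduct, dotProduct_sub, smul_dotProduct,
    dotProduct_smul, smul_eq_mul]
  rw [mulVec_dotProduct_comm hB y x]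
  ring

theorem form_sub_form_le (hB : B.IsHermitian) (x y : W → ℝ) :
    B *ᵥ x ⬝ᵥ x - B *ᵥ y ⬝ᵥ y ≤
      (x - y) ⬝ᵥ (x - y) + (B *ᵥ x ⬝ᵥ B *ᵥ x + B *ᵥ y ⬝ᵥ B *ᵥ y) / 2 := by
  have hyoung := two_mul_dotProduct_le (x - y) (B *ᵥ x + B *ᵥ y) (1 / 2)
  have hsq := dotProduct_star_self_nonneg (B *ᵥ x - B *ᵥ y)
  have hcomm := mulVec_dotProduct_comm hB x y
  simp only [star_trivial, sub_dotProduct, dotProduct_sub, dotProduct_add,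
    dotProduct_comm x (B *ᵥ _), dotProduct_comm y (B *ᵥ _), add_dotProduct,
    dotProduct_comm (B *ᵥ y) (B *ᵥ x)] at hyoung hsq ⊢
  linarith

theorem form_zero_sub_form_le_sum (hB : B.IsHermitian) (x : ℕ → W → ℝ) (n : ℕ) :
    B *ᵥ x 0 ⬝ᵥ x 0 - B *ᵥ x n ⬝ᵥ x n ≤
      ∑ j ∈ Finset.range n, ((x j - x (j + 1)) ⬝ᵥ (x j - x (j + 1)) +
        (B *ᵥ x j ⬝ᵥ B *ᵥ x j + B *ᵥ x (j + 1) ⬝ᵥ B *ᵥ x (j + 1)) / 2) := by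
  rw [← Finset.sum_range_sub' fun j => B *ᵥ x j ⬝ᵥ x j]
  exact Finset.sum_le_sum fun j _ => form_sub_form_le hB _ _

theorem dotProduct_self_le_mul_form (hB : B.PosSemidef) {S : Submodule ℝ (W → ℝ)}
    (hS : ∀ x ∈ S, B *ᵥ x ∈ S) {r : ℝ} (hr : 0 < r)
    (hgap : ∀ x ∈ S, x ⬝ᵥ x ≤ r ^ 2 * (B *ᵥ x ⬝ᵥ B *ᵥ x)) {x : W → ℝ} (hx : x ∈ S) :
    x ⬝ᵥ x ≤ r * (B *ᵥ x ⬝ᵥ x) := by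
  have hinj : Function.Injective (B.mulVecLin.restrict hS) := by
    rw [← LinearMap.ker_eq_bot, LinearMap.ker_eq_bot']
    rintro ⟨y, hy⟩ hBy
    have hBy : B *ᵥ y = 0 := congrArg Subtype.val hBy
    have hy0 := hgap y hy
    rw [hBy, zero_dotProduct, mul_zero] at hy0
    simpa using dotProduct_self_eq_zero.1 (hy0.antisymm (dotProduct_star_self_nonneg y))
  obtain ⟨⟨ξ, hξ⟩, hBξ⟩ := LinearMap.injective_iff_surjective.1 hinj ⟨x, hx⟩
  have hBξ : B *ᵥ ξ = x := congrArg Subtype.val hBξ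
  have hξx : ξ ⬝ᵥ x ≤ r * (x ⬝ᵥ x) := dotProduct_le_mul hr (hBξ ▸ hgap ξ hξ) le_rfl
  have hform := mulVec_dotProduct_self_nonneg hB (ξ - r • x)
  rw [mulVec_sub_smul_dotProduct_self hB.isHermitian, hBξ, dotProduct_comm x ξ] at hform
  exact le_of_mul_le_mul_left (by linarith) hr

/-- The iterates of `x ↦ x - τ B x`, gradient descent for the quadratic form of `B`. -/
def descent (B : Matrix W W ℝ) (τ : ℝ) (x : W → ℝ) (j : ℕ) : W → ℝ :=
  (fun y => y - τ • B *ᵥ y)^[j] x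

theorem descent_succ (τ : ℝ) (x : W → ℝ) (j : ℕ) :
    descent B τ x (j + 1) = descent B τ x j - τ • B *ᵥ descent B τ x j :=
  Function.iterate_succ_apply' ..

variable {τ : ℝ}

theorem mul_dotProduct_le_form_sub_form (hB : B.IsHermitian) (hτ : 0 ≤ τ)
    (h : ∀ x : W → ℝ, τ ^ 2 * (B *ᵥ x ⬝ᵥ B *ᵥ x) ≤ x ⬝ᵥ x) (x : W → ℝ) :
    τ * (B *ᵥ x ⬝ᵥ B *ᵥ x) ≤
      B *ᵥ x ⬝ᵥ x - B *ᵥ (x - τ • B *ᵥ x) ⬝ᵥ (x - τ • B *ᵥ x) := by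
  have hyoung := two_mul_dotProduct_le (B *ᵥ x) (B *ᵥ (B *ᵥ x)) τ
  rw [dotProduct_comm (B *ᵥ x) (B *ᵥ (B *ᵥ x))] at hyoung
  have hform : τ * (B *ᵥ (B *ᵥ x) ⬝ᵥ B *ᵥ x) ≤ B *ᵥ x ⬝ᵥ B *ᵥ x := by linarith [h (B *ᵥ x)]
  rw [mulVec_sub_smul_dotProduct_self hB]
  linarith [mul_le_mul_of_nonneg_left hform hτ]

theorem mul_sum_descent_le (hB : B.PosSemidef) (hτ : 0 ≤ τ)
    (h : ∀ x : W → ℝ, τ ^ 2 * (B *ᵥ x ⬝ᵥ B *ᵥ x) ≤ x ⬝ᵥ x) (x : W → ℝ) (n : ℕ) :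
    τ * ∑ j ∈ Finset.range n, B *ᵥ descent B τ x j ⬝ᵥ B *ᵥ descent B τ x j ≤ B *ᵥ x ⬝ᵥ x := by
  set v := descent B τ x
  calc τ * ∑ j ∈ Finset.range n, B *ᵥ v j ⬝ᵥ B *ᵥ v j
      ≤ ∑ j ∈ Finset.range n, (B *ᵥ v j ⬝ᵥ v j - B *ᵥ v (j + 1) ⬝ᵥ v (j + 1)) := by
        rw [Finset.mul_sum]
        refine Finset.sum_le_sum fun j _ => ?_
        rw [show v (j + 1) = v j - τ • B *ᵥ v j from descent_succ τ x j]
        exact mul_dotProduct_le_form_sub_form hB.isHermitian hτ h (v j)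
    _ = B *ᵥ x ⬝ᵥ x - B *ᵥ v n ⬝ᵥ v n := Finset.sum_range_sub' (fun j => B *ᵥ v j ⬝ᵥ v j) n
    _ ≤ B *ᵥ x ⬝ᵥ x := sub_le_self _ (mulVec_dotProduct_self_nonneg hB _)

theorem dotProduct_descent_le (hB : B.PosSemidef) (hτ : 0 ≤ τ)
    (h : ∀ x : W → ℝ, τ ^ 2 * (B *ᵥ x ⬝ᵥ B *ᵥ x) ≤ x ⬝ᵥ x) (x : W → ℝ) (n : ℕ) :
    descent B τ x n ⬝ᵥ descent B τ x n ≤ x ⬝ᵥ x := by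
  induction n with
  | zero => exact le_rfl
  | succ n ih =>
    refine le_trans ?_ ih
    rw [descent_succ]
    set y := descent B τ x n
    have hstep : τ * (B *ᵥ y ⬝ᵥ B *ᵥ y) ≤ B *ᵥ y ⬝ᵥ y := by
      linarith [mul_dotProduct_le_form_sub_form hB.isHermitian hτ h y,
        mulVec_dotProduct_self_nonneg hB (y - τ • B *ᵥ y)]
    have hform := mul_nonneg hτ (mulVec_dotProduct_self_nonneg hB y)
    simp only [sub_dotProduct, dotProduct_sub, smul_dotProduct, dotProduct_smul,
      smul_eq_mul, dotProduct_comm y (B *ᵥ y)]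
    linarith [mul_le_mul_of_nonneg_left hstep hτ]

end QuadraticForms

section SquareRoot

variable {W : Type*} [Fintype W] [DecidableEq W]

theorem posSemidef_cfc_sqrt (A : Matrix W W ℝ) : (cfc Real.sqrt A).PosSemidef := by
  open scoped MatrixOrder in
  exact nonneg_iff_posSemidef.1 (cfc_nonneg fun x _ => Real.sqrt_nonneg x)

theorem cfc_sqrt_mul_self {A : Matrix W W ℝ} (hA : A.PosSemidef) :
    cfc Real.sqrt A * cfc Real.sqrt A = A := by
  open scoped MatrixOrder in
  have hA := nonneg_iff_posSemidef.2 hA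
  rw [← cfc_mul Real.sqrt Real.sqrt A]
  conv_rhs => rw [← cfc_id ℝ A]
  exact cfc_congr fun x hx => Real.mul_self_sqrt (spectrum_nonneg_of_nonneg hA hx)

end SquareRoot

section Energy

theorem sum_darts_map_sub {V : Type*} {G : SimpleGraph V} (u : V → ℝ) {p q : V} (w : G.Walk p q) :
    (w.darts.map fun d => u d.fst - u d.snd).sum = u p - u q := by
  induction w with
  | nil => simp
  | cons _ _ ih => simp [ih]

variable {V : Type*} [Fintype V] (G : SimpleGraph V)

/-- The Dirichlet energy `∑ (u p - u q)²`, the sum being over the edges `{p, q}` of the graph. -/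
noncomputable def energy (u : V → ℝ) : ℝ :=
  (∑ p, ∑ q, if G.Adj p q then (u p - u q) ^ 2 else 0) / 2

theorem energy_nonneg (u : V → ℝ) : 0 ≤ energy G u := by
  unfold energy
  positivity

theorem lapMatrix_mulVec_dotProduct_self [DecidableEq V] [DecidableRel G.Adj] (u : V → ℝ) :
    G.lapMatrix ℝ *ᵥ u ⬝ᵥ u = energy G u := by
  rw [dotProduct_comm, ← toLinearMap₂'_apply', lapMatrix_toLinearMap₂', energy]
  congr!

theorem sqrt_lapMatrix_mulVec_dotProduct_self [DecidableEq V] [DecidableRel G.Adj] (u : V → ℝ) :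
    cfc Real.sqrt (G.lapMatrix ℝ) *ᵥ u ⬝ᵥ cfc Real.sqrt (G.lapMatrix ℝ) *ᵥ u = energy G u := by
  rw [mulVec_dotProduct_comm (posSemidef_cfc_sqrt _).isHermitian, mulVec_mulVec,
    cfc_sqrt_mul_self (posSemidef_lapMatrix ℝ G), lapMatrix_mulVec_dotProduct_self]

theorem sqrt_lapMatrix_mulVec_const [DecidableEq V] [DecidableRel G.Adj] (a : ℝ) :
    cfc Real.sqrt (G.lapMatrix ℝ) *ᵥ (fun _ => a) = 0 := by
  rw [← dotProduct_self_eq_zero, sqrt_lapMatrix_mulVec_dotProduct_self]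
  simp [energy]

theorem sum_darts_sq_sub (u : V → ℝ) :
    ∑ d : G.Dart, (u d.fst - u d.snd) ^ 2 = 2 * energy G u := by
  rw [energy, mul_div_cancel₀ _ two_ne_zero, ← Finset.sum_product', ← Finset.sum_filter]
  refine Finset.sum_bij' (fun d _ => d.toProd)
    (fun x hx => ⟨x, (Finset.mem_filter.mp hx).2⟩) ?_ ?_ ?_ ?_ ?_ <;> simp

theorem energy_induce_domRestrict (S : Set V) (u : V → ℝ) :
    energy (G.induce S) (S.domRestrict u) =
      (∑ p, ∑ q, if G.Adj p q ∧ p ∈ S ∧ q ∈ S then (u p - u q) ^ 2 else 0) / 2 := by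
  have hsum (f : V → ℝ) (hf : ∀ p ∉ S, f p = 0) : ∑ p : S, f p = ∑ p, f p := by
    rw [← Fintype.sum_subtype_add_sum_subtype (· ∈ S), left_eq_add]
    exact Finset.sum_eq_zero fun p _ => hf p p.2
  unfold energy
  congr 1
  rw [← hsum _ fun p hp => by simp [hp]]
  refine Finset.sum_congr rfl fun p _ => ?_
  rw [← hsum _ fun q hq => by simp [hq]]
  simp [Set.domRestrict]

theorem sum_energy_induce_le {ι : Type*} [Fintype ι] {S : ι → Set V} {n : ℕ}
    (hS : ∀ p, Finset.card {i | p ∈ S i} ≤ n) (u : V → ℝ) :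
    ∑ i, energy (G.induce (S i)) ((S i).domRestrict u) ≤ n * energy G u := by
  simp only [energy_induce_domRestrict, ← Finset.sum_div]
  rw [energy, mul_div_assoc']
  gcongr
  rw [Finset.sum_comm, Finset.mul_sum]
  refine Finset.sum_le_sum fun p _ => ?_
  rw [Finset.sum_comm, Finset.mul_sum]
  refine Finset.sum_le_sum fun q _ => ?_
  split_ifs with hpq
  · calc ∑ i, (if G.Adj p q ∧ p ∈ S i ∧ q ∈ S i then (u p - u q) ^ 2 else 0)
        ≤ ∑ i, if p ∈ S i then (u p - u q) ^ 2 else 0 := by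
          refine Finset.sum_le_sum fun i _ => ?_
          split_ifs <;> first | tauto | positivity
      _ = Finset.card {i | p ∈ S i} * (u p - u q) ^ 2 := by
          rw [← Finset.sum_filter, Finset.sum_const, nsmul_eq_mul]
      _ ≤ n * (u p - u q) ^ 2 := by
          gcongr
          exact hS p
  · simp [hpq]

variable {G}

theorem sum_darts_sq_sub_le_energy {p q : V} {w : G.Walk p q} (hw : w.IsTrail) (u : V → ℝ) :
    ∑ d ∈ w.darts.toFinset, (u d.fst - u d.snd) ^ 2 ≤ energy G u := by
  set s := w.darts.toFinset
  have hdisj : Disjoint s (s.image Dart.symm) := by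
    rw [Finset.disjoint_left]
    intro _ hsymm himage
    obtain ⟨d, hd, rfl⟩ := Finset.mem_image.1 himage
    exact d.symm_ne <| List.inj_on_of_nodup_map hw.edges_nodup (List.mem_toFinset.1 hsymm)
      (List.mem_toFinset.1 hd) d.edge_symm
  have hsymm : ∑ d ∈ s.image Dart.symm, (u d.fst - u d.snd) ^ 2 =
      ∑ d ∈ s, (u d.fst - u d.snd) ^ 2 := by
    rw [Finset.sum_image Dart.symm_involutive.injective.injOn]
    exact Finset.sum_congr rfl fun d _ => sub_sq_comm _ _
  have hle : ∑ d ∈ s ∪ s.image Dart.symm, (u d.fst - u d.snd) ^ 2 ≤ 2 * energy G u :=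
    (Finset.sum_le_univ_sum_of_nonneg fun d => sq_nonneg _).trans_eq (sum_darts_sq_sub G u)
  rw [Finset.sum_union hdisj, hsymm] at hle
  linarith

theorem sq_sub_le_length_mul_energy {p q : V} {w : G.Walk p q} (hw : w.IsTrail) (u : V → ℝ) :
    (u p - u q) ^ 2 ≤ w.length * energy G u := by
  have hnodup : w.darts.Nodup := hw.edges_nodup.of_map
  calc (u p - u q) ^ 2
      = (∑ d ∈ w.darts.toFinset, (u d.fst - u d.snd)) ^ 2 := by
        rw [List.sum_toFinset _ hnodup, sum_darts_map_sub]
    _ ≤ w.darts.toFinset.card * ∑ d ∈ w.darts.toFinset, (u d.fst - u d.snd) ^ 2 :=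
        sq_sum_le_card_mul_sum_sq
    _ ≤ w.length * energy G u := by
        rw [List.toFinset_card_of_nodup hnodup, w.length_darts]
        gcongr
        exact sum_darts_sq_sub_le_energy hw u

theorem energy_induce_domRestrict_le (S : Set V) (u : V → ℝ) :
    energy (G.induce S) (S.domRestrict u) ≤ energy G u := by
  simpa using sum_energy_induce_le G (S := fun _ : Unit => S) (n := 1)
    (fun p => Finset.card_le_univ _) u

theorem sq_sub_le_card_mul_energy (hG : G.Preconnected) (u : V → ℝ) (p q : V) :
    (u p - u q) ^ 2 ≤ Nat.card V * energy G u := by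
  obtain ⟨w, hw⟩ := (hG p q).exists_isPath
  refine (sq_sub_le_length_mul_energy hw.isTrail u).trans ?_
  have := energy_nonneg G u
  gcongr
  exact Nat.card_eq_fintype_card (α := V) ▸ hw.length_lt.le

theorem sq_sub_le_mul_energy_induce {S : Set V} (hS : (G.induce S).Preconnected) {n : ℕ}
    (hn : S.ncard ≤ n) (u : V → ℝ) {p q : V} (hp : p ∈ S) (hq : q ∈ S) :
    (u p - u q) ^ 2 ≤ n * energy (G.induce S) (S.domRestrict u) := by
  refine (sq_sub_le_card_mul_energy hS (S.domRestrict u) ⟨p, hp⟩ ⟨q, hq⟩).trans ?_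
  have := energy_nonneg (G.induce S) (S.domRestrict u)
  gcongr
  rwa [Nat.card_coe_set_eq]

theorem sum_sq_sub_le_mul_energy {ι : Type*} [Fintype ι] {S : ι → Set V} {m n : ℕ}
    (hconn : ∀ i, (G.induce (S i)).Preconnected) (hcard : ∀ i, (S i).ncard ≤ m)
    (hmult : ∀ p, Finset.card {i | p ∈ S i} ≤ n) (u : V → ℝ) {p q : ι → V} (hp : ∀ i, p i ∈ S i)
    (hq : ∀ i, q i ∈ S i) : ∑ i, (u (p i) - u (q i)) ^ 2 ≤ m * n * energy G u := by
  calc ∑ i, (u (p i) - u (q i)) ^ 2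
      ≤ ∑ i, m * energy (G.induce (S i)) ((S i).domRestrict u) :=
        Finset.sum_le_sum fun i _ =>
          sq_sub_le_mul_energy_induce (hconn i) (hcard i) u (hp i) (hq i)
    _ ≤ m * n * energy G u := by
        rw [← Finset.mul_sum, mul_assoc]
        gcongr
        exact sum_energy_induce_le G hmult u

end Energy

section SchurComplement

variable {V : Type*} {G : SimpleGraph V} {Γ : Set V}

/-- The function on `V` with the values `φ` on `Γ` and `y` off `Γ`. -/
noncomputable def glue (φ : Γ → ℝ) (y : {p // p ∉ Γ} → ℝ) : V → ℝ :=
  Sum.elim φ y ∘ (Equiv.sumCompl (· ∈ Γ)).symm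

theorem glue_of_mem (φ : Γ → ℝ) (y : {p // p ∉ Γ} → ℝ) (p : Γ) : glue φ y p = φ p := by
  simp [glue, Equiv.sumCompl_symm_apply_of_pos p.2]

theorem glue_of_notMem (φ : Γ → ℝ) (y : {p // p ∉ Γ} → ℝ) (p : {p // p ∉ Γ}) :
    glue φ y p = y p := by
  simp [glue, Equiv.sumCompl_symm_apply_of_neg p.2]

theorem glue_domRestrict (u : V → ℝ) : glue (Γ.domRestrict u) (fun p => u p) = u := by
  funext p
  by_cases hp : p ∈ Γ
  · exact glue_of_mem _ _ ⟨p, hp⟩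
  · exact glue_of_notMem _ _ ⟨p, hp⟩

variable [Fintype V]

theorem mulVec_glue_dotProduct_glue (A : Matrix V V ℝ) (φ : Γ → ℝ) (y : {p // p ∉ Γ} → ℝ) :
    A *ᵥ glue φ y ⬝ᵥ glue φ y =
      fromBlocks (A.toBlock (· ∈ Γ) (· ∈ Γ)) (A.toBlock (· ∈ Γ) (· ∉ Γ))
        (A.toBlock (· ∉ Γ) (· ∈ Γ)) (A.toBlock (· ∉ Γ) (· ∉ Γ)) *ᵥ Sum.elim φ y ⬝ᵥ
          Sum.elim φ y := by
  set e := Equiv.sumCompl (· ∈ Γ)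
  have hblocks : fromBlocks (A.toBlock (· ∈ Γ) (· ∈ Γ)) (A.toBlock (· ∈ Γ) (· ∉ Γ))
      (A.toBlock (· ∉ Γ) (· ∈ Γ)) (A.toBlock (· ∉ Γ) (· ∉ Γ)) = A.submatrix e e := by
    ext (i | i) (j | j) <;> rfl
  rw [hblocks, submatrix_mulVec_equiv, ← dotProduct_comp_equiv_symm]
  rfl

theorem posDef_lapMatrix_toBlock_compl (hG : G.Preconnected) (hΓ : Γ.Nonempty) :
    ((G.lapMatrix ℝ).toBlock (· ∉ Γ) (· ∉ Γ)).PosDef := by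
  refine PosDef.of_dotProduct_mulVec_pos ((isHermitian_lapMatrix ℝ G).submatrix _) fun y hy => ?_
  have hform := mulVec_glue_dotProduct_glue (Γ := Γ) (G.lapMatrix ℝ) 0 y
  rw [lapMatrix_mulVec_dotProduct_self, fromBlocks_mulVec, Sum.elim_comp_inl, Sum.elim_comp_inr,
    mulVec_zero, mulVec_zero, zero_add, zero_add, sumElim_dotProduct_sumElim, dotProduct_zero,
    zero_add, dotProduct_comm] at hform
  rw [star_trivial, ← hform]
  refine (energy_nonneg G _).lt_of_ne' fun henergy => hy ?_
  obtain ⟨a, ha⟩ := hΓ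
  funext p
  have hconst := sq_sub_le_card_mul_energy hG (glue (0 : Γ → ℝ) y) p a
  rw [henergy, mul_zero, glue_of_notMem, glue_of_mem 0 y ⟨a, ha⟩, Pi.zero_apply, sub_zero] at hconst
  exact pow_eq_zero_iff two_ne_zero |>.1 (hconst.antisymm (sq_nonneg _))

theorem energy_glue (hG : G.Preconnected) (hΓ : Γ.Nonempty) (φ : Γ → ℝ) (y : {p // p ∉ Γ} → ℝ) :
    let L := G.lapMatrix ℝ
    let D := L.toBlock (· ∉ Γ) (· ∉ Γ)
    let z := (D⁻¹ * L.toBlock (· ∉ Γ) (· ∈ Γ)) *ᵥ φ + y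
    energy G (glue φ y) = quadForm (schurComplement G Γ) φ + D *ᵥ z ⬝ᵥ z := by
  intro L D z
  have hD : D.PosDef := posDef_lapMatrix_toBlock_compl hG hΓ
  have := hD.isUnit.invertible
  have hC : L.toBlock (· ∉ Γ) (· ∈ Γ) = (L.toBlock (· ∈ Γ) (· ∉ Γ))ᴴ :=
    congrArg (fun A : Matrix V V ℝ => A.toBlock (· ∉ Γ) (· ∈ Γ)) (isHermitian_lapMatrix ℝ G).eq.symm
  have hschur := schur_complement_eq₂₂ (L.toBlock (· ∈ Γ) (· ∈ Γ)) (L.toBlock (· ∈ Γ) (· ∉ Γ))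
    φ y hD.isHermitian
  simp only [star_trivial, ← dotProduct_mulVec, ← hC] at hschur
  rw [← lapMatrix_mulVec_dotProduct_self, mulVec_glue_dotProduct_glue, dotProduct_comm, hschur,
    add_comm, dotProduct_comm φ, dotProduct_comm z]
  rfl

theorem quadForm_schurComplement_le_energy (hG : G.Preconnected) (hΓ : Γ.Nonempty) (u : V → ℝ) :
    quadForm (schurComplement G Γ) (Γ.domRestrict u) ≤ energy G u := by
  have h := energy_glue hG hΓ (Γ.domRestrict u) fun p => u p
  rw [glue_domRestrict] at h
  rw [h]
  exact le_add_of_nonneg_right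
    (mulVec_dotProduct_self_nonneg (posDef_lapMatrix_toBlock_compl hG hΓ).posSemidef _)

theorem exists_energy_eq_quadForm_schurComplement (hG : G.Preconnected) (hΓ : Γ.Nonempty)
    (φ : Γ → ℝ) :
    ∃ u : V → ℝ, Γ.domRestrict u = φ ∧ energy G u = quadForm (schurComplement G Γ) φ := by
  let L := G.lapMatrix ℝ
  refine ⟨glue φ (-((L.toBlock (· ∉ Γ) (· ∉ Γ))⁻¹ * L.toBlock (· ∉ Γ) (· ∈ Γ)) *ᵥ φ),
    funext fun p => glue_of_mem _ _ p, ?_⟩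
  rw [energy_glue hG hΓ, neg_mulVec, add_neg_cancel, dotProduct_zero, add_zero]

end SchurComplement

section Labelling

/-- Two columns, numbered modulo `k`, are equal or consecutive. -/
def Near {k : ℕ} [NeZero k] (i i' : Fin k) : Prop := i' = i ∨ i' = i + 1 ∨ i = i' + 1

theorem Near.symm {k : ℕ} [NeZero k] {i i' : Fin k} (h : Near i i') : Near i' i :=
  h.imp Eq.symm Or.symm

theorem cycleGraph_adj_iff {k : ℕ} [NeZero k] (hk : 2 ≤ k) {i i' : Fin k} :
    (cycleGraph k).Adj i i' ↔ i' = i + 1 ∨ i = i' + 1 := by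
  obtain ⟨n, rfl⟩ := Nat.exists_eq_add_of_le' hk
  rw [cycleGraph_adj, sub_eq_iff_eq_add', sub_eq_iff_eq_add', or_comm, add_comm i, add_comm i']

theorem near_and_le_of_annulusStar_adj {k ℓ : ℕ} [NeZero k] (hk : 2 ≤ k) {x y : Fin k × Fin ℓ}
    (h : (annulusStar k ℓ).Adj x y) : Near x.1 y.1 ∧ (y.2 : ℕ) ≤ x.2 + 1 := by
  rcases h with h | h
  · rw [annulus, boxProd_adj, cycleGraph_adj_iff hk, pathGraph_adj] at h
    rcases h with ⟨hcol, hrow⟩ | ⟨hrow, hcol⟩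
    · exact ⟨Or.inr hcol, hrow ▸ Nat.le_succ _⟩
    · exact ⟨Or.inl hcol.symm, by omega⟩
  · rw [fromRel_adj, cycleGraph_adj_iff hk, cycleGraph_adj_iff hk] at h
    rcases h.2 with ⟨hcol, hrow⟩ | ⟨hcol, hrow⟩
    · exact ⟨Or.inr hcol, hrow.le⟩
    · exact ⟨Near.symm (Or.inr hcol), by omega⟩

variable {V : Type*} {G : SimpleGraph V} {Γ : Set V} {k ℓ M : ℕ}

/-- The vertices in column `i` and row `j`. -/
def cell (col : V → Fin k) (row : V → ℕ) (i : Fin k) (j : ℕ) : Set V :=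
  {p | col p = i ∧ row p = j}

/-- An aggregation, described by the column and the row of each vertex: the rows less than `ℓ` are
those of the aggregates, and the vertices outside the aggregates are assigned a row `≥ ℓ`. -/
structure IsLabelling (G : SimpleGraph V) (Γ : Set V) (k ℓ M : ℕ) [NeZero k]
    (col : V → Fin k) (row : V → ℕ) : Prop where
  near : ∀ {p q}, G.Adj p q → row p < ℓ → row q < ℓ → Near (col p) (col q)
  row_le : ∀ {p q}, G.Adj p q → row p < ℓ → row q < ℓ → row q ≤ row p + 1
  last_row : ∀ {p q}, G.Adj p q → row p < ℓ → ℓ ≤ row q → row p + 1 = ℓ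
  connected : ∀ i j, j < ℓ → (G.induce (cell col row i j)).Connected
  ncard_le : ∀ i j, j < ℓ → (cell col row i j).ncard ≤ M
  boundary_row : ∀ p ∈ Γ, row p = 0
  boundary_col : ∀ i, ∃ p ∈ Γ, col p = i
  horizontal : ∀ i j, j < ℓ → ∃ p ∈ cell col row i j, ∃ q ∈ cell col row (i + 1) j, G.Adj p q
  vertical : ∀ i j, j + 1 < ℓ → ∃ p ∈ cell col row i j, ∃ q ∈ cell col row i (j + 1), G.Adj p q

namespace IsAggregationPartition

variable {H : SimpleGraph (Fin k × Fin ℓ)} {aStar : Set V} {a : Fin k × Fin ℓ → Set V} {p q : V}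
  {x y : Fin k × Fin ℓ}

/-- The column and the row of the aggregate that contains `p`; the vertices outside the aggregates
are assigned the column `0` and the row `ℓ`. -/
noncomputable def label [NeZero k] (a : Fin k × Fin ℓ → Set V) (p : V) : Fin k × ℕ :=
  if hp : ∃ x, p ∈ a x then (hp.choose.1, hp.choose.2) else (0, ℓ)

variable (h : IsAggregationPartition M G Γ H aStar a)
include h

theorem eq_of_mem_of_mem (hx : p ∈ a x) (hy : p ∈ a y) : x = y := by
  by_contra hne
  exact Set.disjoint_left.1 (h.disjoint x y hne) hx hy

theorem adj_of_adj (hx : p ∈ a x) (hy : q ∈ a y) (hne : x ≠ y) (hpq : G.Adj p q) : H.Adj x y := by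
  rw [← h.aggregationGraph_eq]
  exact ⟨hne, p, hx, q, hy, hpq⟩

theorem exists_adj_of_adj (hxy : H.Adj x y) : ∃ p ∈ a x, ∃ q ∈ a y, G.Adj p q := by
  rw [← h.aggregationGraph_eq] at hxy
  exact hxy.2

theorem add_one_eq_of_adj_of_forall_notMem (hx : p ∈ a x) (hq : ∀ y, q ∉ a y) (hpq : G.Adj p q) :
    (x.2 : ℕ) + 1 = ℓ := by
  have hstar : q ∈ aStar := by
    have hmem : q ∈ aStar ∪ ⋃ y, a y := h.union_eq ▸ Set.mem_univ q
    simpa [hq] using hmem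
  rcases h.star_neighbors q hstar p hpq.symm with hp | ⟨y, hlast, hy⟩
  · exact absurd hx (Set.disjoint_left.1 (h.disjoint_star x) hp)
  · rwa [h.eq_of_mem_of_mem hx hy]

variable [NeZero k]

theorem label_of_mem (hx : p ∈ a x) : label a p = (x.1, (x.2 : ℕ)) := by
  have hp : ∃ x, p ∈ a x := ⟨x, hx⟩
  rw [label, dif_pos hp, h.eq_of_mem_of_mem hp.choose_spec hx]

theorem label_snd_lt_iff : (label a p).2 < ℓ ↔ ∃ x, p ∈ a x := by
  refine ⟨fun hp => ?_, fun ⟨x, hx⟩ => ?_⟩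
  · by_contra hne
    rw [label, dif_neg hne] at hp
    exact lt_irrefl ℓ hp
  · rw [h.label_of_mem hx]
    exact x.2.2

theorem cell_label (i : Fin k) {j : ℕ} (hj : j < ℓ) :
    cell (fun p => (label a p).1) (fun p => (label a p).2) i j = a (i, ⟨j, hj⟩) := by
  ext p
  refine ⟨fun ⟨hcol, hrow⟩ => ?_, fun hp => by simp [cell, h.label_of_mem hp]⟩
  obtain ⟨x, hx⟩ := h.label_snd_lt_iff.1 (hrow.trans_lt hj)
  simp only [h.label_of_mem hx] at hcol hrow
  rwa [← show x = (i, ⟨j, hj⟩) from Prod.ext hcol (Fin.ext hrow)]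

theorem near_and_le_of_adj (hk : 2 ≤ k) (hH : H ≤ annulusStar k ℓ) (hpq : G.Adj p q)
    (hp : (label a p).2 < ℓ) (hq : (label a q).2 < ℓ) :
    Near (label a p).1 (label a q).1 ∧ (label a q).2 ≤ (label a p).2 + 1 := by
  obtain ⟨x, hx⟩ := h.label_snd_lt_iff.1 hp
  obtain ⟨y, hy⟩ := h.label_snd_lt_iff.1 hq
  rw [h.label_of_mem hx, h.label_of_mem hy]
  obtain rfl | hne := eq_or_ne x y
  · exact ⟨Or.inl rfl, Nat.le_succ _⟩
  · exact near_and_le_of_annulusStar_adj hk (hH (h.adj_of_adj hx hy hne hpq))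

theorem isLabelling (hk : 2 ≤ k) (hℓ : 0 < ℓ) (hH₁ : annulus k ℓ ≤ H) (hH₂ : H ≤ annulusStar k ℓ) :
    IsLabelling G Γ k ℓ M (fun p => (label a p).1) (fun p => (label a p).2) where
  near hpq hp hq := (h.near_and_le_of_adj hk hH₂ hpq hp hq).1
  row_le hpq hp hq := (h.near_and_le_of_adj hk hH₂ hpq hp hq).2
  last_row hpq hp hq := by
    obtain ⟨x, hx⟩ := h.label_snd_lt_iff.1 hp
    rw [h.label_of_mem hx]
    refine h.add_one_eq_of_adj_of_forall_notMem hx (fun y hy => ?_) hpq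
    exact hq.not_gt (h.label_snd_lt_iff.2 ⟨y, hy⟩)
  connected i j hj := h.cell_label i hj ▸ h.connected _
  ncard_le i j hj := h.cell_label i hj ▸ h.ncard_le _
  boundary_row p hp := by
    obtain ⟨x, hx, hpx⟩ := h.boundary_subset p hp
    rw [h.label_of_mem hpx, hx]
  boundary_col i := by
    obtain ⟨p, hpΓ, hp⟩ := h.boundary_inter (i, ⟨0, hℓ⟩) rfl
    exact ⟨p, hpΓ, by rw [h.label_of_mem hp]⟩
  horizontal i j hj := by
    rw [h.cell_label i hj, h.cell_label (i + 1) hj]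
    refine h.exists_adj_of_adj (hH₁ (Or.inl ⟨?_, rfl⟩))
    exact (cycleGraph_adj_iff hk).2 (Or.inl rfl)
  vertical i j hj := by
    rw [h.cell_label i (Nat.lt_of_succ_lt hj), h.cell_label i hj]
    exact h.exists_adj_of_adj (hH₁ (Or.inr ⟨pathGraph_adj.2 (Or.inl rfl), rfl⟩))

end IsAggregationPartition

end Labelling

/-! ### The lower bound -/

/-- The Dirichlet energy of a function of the column along the cycle of all columns. -/
def cycleEnergy {k : ℕ} [NeZero k] (f : Fin k → ℝ) : ℝ :=
  ∑ i, (f (i + 1) - f i) ^ 2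

theorem cycleEnergy_nonneg {k : ℕ} [NeZero k] (f : Fin k → ℝ) : 0 ≤ cycleEnergy f :=
  Finset.sum_nonneg fun _ _ => sq_nonneg _

theorem sq_sub_zero_le_mul_cycleEnergy {k : ℕ} [NeZero k] (f : Fin k → ℝ) (i : Fin k) :
    (f i - f 0) ^ 2 ≤ k * cycleEnergy f := by
  let g (m : ℕ) : ℝ := f (Fin.ofNat k m)
  have hg (i : Fin k) : g i = f i := by simp [g]
  have hg_succ (i : Fin k) : g (i + 1) = f (i + 1) := congrArg f <| by ext; simp [Fin.val_add]
  calc (f i - f 0) ^ 2 = (∑ m ∈ Finset.range i, (g (m + 1) - g m)) ^ 2 := by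
        rw [Finset.sum_range_sub, hg]
        rfl
    _ ≤ (i : ℕ) * ∑ m ∈ Finset.range i, (g (m + 1) - g m) ^ 2 := by
        simpa using sq_sum_le_card_mul_sum_sq (s := Finset.range i) (f := fun m => g (m + 1) - g m)
    _ ≤ k * ∑ m ∈ Finset.range k, (g (m + 1) - g m) ^ 2 := by
        gcongr
        · exact i.2.le
        · exact i.2.le
    _ = k * cycleEnergy f := by
        simp only [Finset.sum_range, hg, hg_succ, cycleEnergy]

namespace IsLabelling

section

variable {V : Type*} {G : SimpleGraph V} {Γ : Set V} {k ℓ M : ℕ} [NeZero k]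
  {col : V → Fin k} {row : V → ℕ} (h : IsLabelling G Γ k ℓ M col row)
include h

theorem exists_mem_cell : ∃ r : Fin k → ℕ → V, ∀ i j, j < ℓ → r i j ∈ cell col row i j := by
  have hcell (i : Fin k) (j : ℕ) : ∃ p, j < ℓ → p ∈ cell col row i j := by
    by_cases hj : j < ℓ
    · obtain ⟨⟨p, hp⟩⟩ := (h.connected i j hj).nonempty
      exact ⟨p, fun _ => hp⟩
    · obtain ⟨p, -⟩ := h.boundary_col i
      exact ⟨p, fun hj' => absurd hj' hj⟩
  choose r hr using hcell
  exact ⟨r, hr⟩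

theorem near_boundary (hℓ : 0 < ℓ) {p q : Γ} (hpq : G.Adj p q) : Near (col p) (col q) :=
  h.near hpq ((h.boundary_row p p.2).trans_lt hℓ) ((h.boundary_row q q.2).trans_lt hℓ)

theorem preconnected_cell_union {i i' : Fin k} {j j' : ℕ} (hj : j < ℓ) (hj' : j' < ℓ)
    (hadj : ∃ p ∈ cell col row i j, ∃ q ∈ cell col row i' j', G.Adj p q) :
    (G.induce (cell col row i j ∪ cell col row i' j')).Preconnected := by
  obtain ⟨p, hp, q, hq, hpq⟩ := hadj
  exact (connected_induce_union (h.connected i j hj).preconnected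
    (h.connected i' j' hj').preconnected hp hq hpq).preconnected

theorem ncard_cell_union_le {i i' : Fin k} {j j' : ℕ} (hj : j < ℓ) (hj' : j' < ℓ) :
    (cell col row i j ∪ cell col row i' j').ncard ≤ 2 * M :=
  (Set.ncard_union_le _ _).trans (by linarith [h.ncard_le i j hj, h.ncard_le i' j' hj'])

theorem one_le [Finite V] (hℓ : 0 < ℓ) : 1 ≤ M := by
  obtain ⟨⟨p, hp⟩⟩ := (h.connected 0 0 hℓ).nonempty
  exact ((Set.ncard_pos (Set.toFinite _)).2 ⟨p, hp⟩).trans_le (h.ncard_le 0 0 hℓ)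

variable [Fintype V]

theorem card_boundary_col_le (hℓ : 0 < ℓ) (i : Fin k) :
    Finset.card {p : Γ | col p = i} ≤ M := by
  refine le_trans ?_ (h.ncard_le i 0 hℓ)
  rw [Set.ncard_eq_toFinset_card']
  refine Finset.card_le_card_of_injOn Subtype.val (fun p hp => ?_) Subtype.val_injective.injOn
  have hp : col p = i := by simpa using hp
  simpa using ⟨hp, h.boundary_row p p.2⟩

theorem sum_boundary_comp_col_le (hℓ : 0 < ℓ) {f : Fin k → ℝ} (hf : ∀ i, 0 ≤ f i) :
    ∑ p : Γ, f (col p) ≤ M * ∑ i, f i := by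
  rw [← Finset.sum_fiberwise' Finset.univ (fun p : Γ => col p) f, Finset.mul_sum]
  refine Finset.sum_le_sum fun i _ => ?_
  rw [Finset.sum_const, nsmul_eq_mul]
  have := hf i
  gcongr
  exact h.card_boundary_col_le hℓ i

theorem energy_boundary_comp_col_le (hℓ : 0 < ℓ) (f : Fin k → ℝ) :
    energy (G.induce Γ) (fun p => f (col p)) ≤ M ^ 2 * cycleEnergy f := by
  let D (i : Fin k) : ℝ := (f (i + 1) - f i) ^ 2
  let T (p q : Γ) : ℝ := if col q = col p + 1 then D (col p) else 0
  have hT (p q : Γ) : 0 ≤ T p q := by positivity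
  have hD : ∀ i, 0 ≤ D i := fun i => sq_nonneg _
  have hle {p q : Γ} (hpq : (G.induce Γ).Adj p q) :
      (f (col p) - f (col q)) ^ 2 ≤ T p q + T q p := by
    rcases h.near_boundary hℓ hpq with hcol | hcol | hcol
    · rw [hcol, sub_self, zero_pow two_ne_zero]
      exact add_nonneg (hT p q) (hT q p)
    · refine le_trans (le_of_eq ?_) (le_add_of_nonneg_right (hT q p))
      simp only [T, D, if_pos hcol, hcol, sub_sq_comm]
    · refine le_trans (le_of_eq ?_) (le_add_of_nonneg_left (hT p q))
      simp only [T, D, if_pos hcol, hcol]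
  have hsum : ∑ p, ∑ q, T p q ≤ M ^ 2 * cycleEnergy f := by
    calc ∑ p, ∑ q, T p q ≤ ∑ p : Γ, M * D (col p) := by
          refine Finset.sum_le_sum fun p _ => ?_
          rw [← Finset.sum_filter, Finset.sum_const, nsmul_eq_mul]
          have := hD (col p)
          gcongr
          exact h.card_boundary_col_le hℓ _
      _ ≤ M * (M * ∑ i, D i) := by
          rw [← Finset.mul_sum]
          gcongr
          exact h.sum_boundary_comp_col_le hℓ hD
      _ = M ^ 2 * cycleEnergy f := by rw [cycleEnergy]; ring
  have henergy : 2 * energy (G.induce Γ) (fun p => f (col p)) ≤ ∑ p, ∑ q, (T p q + T q p) := by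
    rw [energy, mul_div_cancel₀ _ two_ne_zero]
    refine Finset.sum_le_sum fun p _ => Finset.sum_le_sum fun q _ => ?_
    split_ifs with hpq
    · exact hle hpq
    · exact add_nonneg (hT p q) (hT q p)
  have hcomm : ∑ p, ∑ q, T q p = ∑ p, ∑ q, T p q := Finset.sum_comm
  simp only [Finset.sum_add_distrib, hcomm] at henergy
  linarith

theorem sum_cycleEnergy_le (u : V → ℝ) {r : Fin k → ℕ → V}
    (hr : ∀ i j, j < ℓ → r i j ∈ cell col row i j) :
    ∑ j ∈ Finset.range ℓ, cycleEnergy (fun i => u (r i j)) ≤ 4 * M * energy G u := by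
  have hconn (x : Fin ℓ × Fin k) :=
    h.preconnected_cell_union x.1.2 x.1.2 (h.horizontal x.2 x.1 x.1.2)
  have hmult (p : V) : Finset.card
      {x : Fin ℓ × Fin k | p ∈ cell col row x.2 x.1 ∪ cell col row (x.2 + 1) x.1} ≤ 2 := by
    refine (Finset.card_le_card_of_injOn (t := {(row p, col p), (row p, col p - 1)})
      (fun x => ((x.1 : ℕ), x.2)) ?_ ?_).trans Finset.card_le_two
    · rintro ⟨j, i⟩ hx
      rcases (Finset.mem_filter.1 hx).2 with ⟨hcol, hrow⟩ | ⟨hcol, hrow⟩ <;> simp [hcol, hrow]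
    · rintro ⟨j, i⟩ - ⟨j', i'⟩ - hx
      simpa [Fin.ext_iff] using hx
  have hsum := sum_sq_sub_le_mul_energy hconn (fun x => h.ncard_cell_union_le x.1.2 x.1.2)
    (fun p => by convert hmult p) u
    (fun x => Or.inr (hr (x.2 + 1) x.1 x.1.2)) fun x => Or.inl (hr x.2 x.1 x.1.2)
  rw [Fintype.sum_prod_type] at hsum
  rw [Finset.sum_range]
  exact hsum.trans_eq (by push_cast; ring)

theorem sum_vertical_sq_sub_le (u : V → ℝ) {r : Fin k → ℕ → V}
    (hr : ∀ i j, j < ℓ → r i j ∈ cell col row i j) :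
    ∑ j ∈ Finset.range (ℓ - 1), ∑ i, (u (r i j) - u (r i (j + 1))) ^ 2 ≤ 4 * M * energy G u := by
  have hlt (j : Fin (ℓ - 1)) : (j : ℕ) + 1 < ℓ := Nat.add_lt_of_lt_sub j.2
  have hlt' (j : Fin (ℓ - 1)) : (j : ℕ) < ℓ := Nat.lt_of_succ_lt (hlt j)
  have hconn (x : Fin (ℓ - 1) × Fin k) :=
    h.preconnected_cell_union (hlt' x.1) (hlt x.1) (h.vertical x.2 x.1 (hlt x.1))
  have hmult (p : V) : Finset.card {x : Fin (ℓ - 1) × Fin k |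
      p ∈ cell col row x.2 x.1 ∪ cell col row x.2 (x.1 + 1)} ≤ 2 := by
    refine (Finset.card_le_card_of_injOn (t := {(row p, col p), (row p - 1, col p)})
      (fun x => ((x.1 : ℕ), x.2)) ?_ ?_).trans Finset.card_le_two
    · rintro ⟨j, i⟩ hx
      rcases (Finset.mem_filter.1 hx).2 with ⟨hcol, hrow⟩ | ⟨hcol, hrow⟩ <;> simp [hcol, hrow]
    · rintro ⟨j, i⟩ - ⟨j', i'⟩ - hx
      simpa [Fin.ext_iff] using hx
  have hsum := sum_sq_sub_le_mul_energy hconn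
    (fun x => h.ncard_cell_union_le (hlt' x.1) (hlt x.1))
    (fun p => by convert hmult p) u
    (fun x => Or.inl (hr x.2 x.1 (hlt' x.1))) fun x => Or.inr (hr x.2 (x.1 + 1) (hlt x.1))
  rw [Fintype.sum_prod_type] at hsum
  rw [Finset.sum_range]
  exact hsum.trans_eq (by push_cast; ring)

theorem sum_boundary_sq_sub_le (hℓ : 0 < ℓ) (u : V → ℝ) {r : Fin k → V}
    (hr : ∀ i, r i ∈ cell col row i 0) :
    ∑ p : Γ, (u p - u (r (col p))) ^ 2 ≤ M ^ 2 * energy G u := by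
  have hmult (q : V) : Finset.card {p : Γ | q ∈ cell col row (col p) 0} ≤ M := by
    refine (Finset.card_le_card fun p hp => ?_).trans (h.card_boundary_col_le hℓ (col q))
    simpa using (Finset.mem_filter.1 hp).2.1.symm
  rw [sq (M : ℝ)]
  exact sum_sq_sub_le_mul_energy (fun p : Γ => (h.connected _ _ hℓ).preconnected)
    (fun p => h.ncard_le (col p) 0 hℓ) hmult u (fun p => ⟨rfl, h.boundary_row p p.2⟩) fun p => hr _

/-- The functions on `Γ` which interpolate between the trace of `u` and a row of small energy: the
trace itself at `0`, and at `j + 1` the function taking at `p` the value of `u` at the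
representative `r (col p) j` of the cell of row `j` below `p`. -/
def layer (Γ : Set V) (col : V → Fin k) (r : Fin k → ℕ → V) (u : V → ℝ) : ℕ → Γ → ℝ
  | 0 => Γ.domRestrict u
  | j + 1 => fun p => u (r (col p) j)

theorem sum_layer_sub_le (hℓ : 0 < ℓ) (u : V → ℝ) {r : Fin k → ℕ → V}
    (hr : ∀ i j, j < ℓ → r i j ∈ cell col row i j) {J : ℕ} (hJ : J < ℓ) :
    ∑ j ∈ Finset.range (J + 1), (layer Γ col r u j - layer Γ col r u (j + 1)) ⬝ᵥ
      (layer Γ col r u j - layer Γ col r u (j + 1)) ≤ 5 * M ^ 2 * energy G u := by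
  let D (j : ℕ) (i : Fin k) : ℝ := (u (r i j) - u (r i (j + 1))) ^ 2
  have hD (j : ℕ) (i : Fin k) : 0 ≤ D j i := sq_nonneg _
  have hfirst : ∑ p : Γ, (u p - u (r (col p) 0)) ^ 2 ≤ M ^ 2 * energy G u :=
    h.sum_boundary_sq_sub_le hℓ u fun i => hr i 0 hℓ
  have hrest : ∑ j ∈ Finset.range J, ∑ p : Γ, D j (col p) ≤ 4 * M ^ 2 * energy G u := by
    calc ∑ j ∈ Finset.range J, ∑ p : Γ, D j (col p)
        ≤ ∑ j ∈ Finset.range (ℓ - 1), ∑ p : Γ, D j (col p) :=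
          Finset.sum_le_sum_of_subset_of_nonneg
            (Finset.range_subset_range.2 (Nat.le_sub_one_of_lt hJ)) fun j _ _ =>
            Finset.sum_nonneg fun p _ => hD j _
      _ ≤ M * ∑ j ∈ Finset.range (ℓ - 1), ∑ i, D j i := by
          rw [Finset.mul_sum]
          exact Finset.sum_le_sum fun j _ => h.sum_boundary_comp_col_le hℓ (hD j)
      _ ≤ M * (4 * M * energy G u) := by
          gcongr
          exact h.sum_vertical_sq_sub_le u hr
      _ = 4 * M ^ 2 * energy G u := by ring
  simp only [dotProduct, ← sq, Finset.sum_range_succ' _ J]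
  exact (add_le_add hrest hfirst).trans_eq (by ring)

theorem sum_energy_layer_le (hℓ : 0 < ℓ) (u : V → ℝ) {r : Fin k → ℕ → V}
    (hr : ∀ i j, j < ℓ → r i j ∈ cell col row i j) :
    ∑ j ∈ Finset.range ℓ, energy (G.induce Γ) (layer Γ col r u (j + 1)) ≤
      4 * M ^ 3 * energy G u := by
  calc _ ≤ ∑ j ∈ Finset.range ℓ, M ^ 2 * cycleEnergy (fun i => u (r i j)) :=
        Finset.sum_le_sum fun j _ => h.energy_boundary_comp_col_le hℓ fun i => u (r i j)
    _ ≤ M ^ 2 * (4 * M * energy G u) := by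
        rw [← Finset.mul_sum]
        gcongr
        exact h.sum_cycleEnergy_le u hr
    _ = 4 * M ^ 3 * energy G u := by ring

theorem sqrt_form_boundary_comp_col_le (hℓ : 0 < ℓ) (f : Fin k → ℝ) :
    cfc Real.sqrt ((G.induce Γ).lapMatrix ℝ) *ᵥ (fun p => f (col p)) ⬝ᵥ (fun p => f (col p)) ≤
      k * (M ^ 2 * cycleEnergy f) := by
  set B := cfc Real.sqrt ((G.induce Γ).lapMatrix ℝ)
  let x (p : Γ) : ℝ := f (col p)
  have hM : (1 : ℝ) ≤ M := mod_cast h.one_le hℓ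
  have hf := cycleEnergy_nonneg f
  have hk : (0 : ℝ) < k := mod_cast NeZero.pos k
  have hB : B.IsHermitian := (posSemidef_cfc_sqrt _).isHermitian
  have hconst : B *ᵥ (fun _ => f 0) = 0 := sqrt_lapMatrix_mulVec_const _ _
  have hshift : B *ᵥ x ⬝ᵥ (x - fun _ => f 0) = B *ᵥ x ⬝ᵥ x := by
    rw [dotProduct_sub, mulVec_dotProduct_comm hB x (fun _ => f 0), hconst, zero_dotProduct,
      sub_zero]
  rw [← hshift, dotProduct_comm]
  refine dotProduct_le_mul hk ?_ ?_
  · calc (x - fun _ => f 0) ⬝ᵥ (x - fun _ => f 0) = ∑ p : Γ, (f (col p) - f 0) ^ 2 := by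
          simp only [dotProduct, sq, x, Pi.sub_apply]
      _ ≤ M * ∑ i, (f i - f 0) ^ 2 :=
          h.sum_boundary_comp_col_le hℓ fun i => sq_nonneg (f i - f 0)
      _ ≤ M * ∑ _i : Fin k, k * cycleEnergy f := by
          gcongr with i
          exact sq_sub_zero_le_mul_cycleEnergy f i
      _ = k ^ 2 * (M * cycleEnergy f) := by
          rw [Finset.sum_const, Finset.card_univ, Fintype.card_fin, nsmul_eq_mul]
          ring
      _ ≤ k ^ 2 * (M ^ 2 * cycleEnergy f) := by
          gcongr
          exact le_self_pow₀ hM two_ne_zero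
  · rw [sqrt_lapMatrix_mulVec_dotProduct_self]
    exact h.energy_boundary_comp_col_le hℓ f

theorem exists_sqrt_form_layer_le (hℓ : 0 < ℓ) {c : ℕ} (hkc : k ≤ 2 * c * ℓ) (u : V → ℝ)
    {r : Fin k → ℕ → V} (hr : ∀ i j, j < ℓ → r i j ∈ cell col row i j) :
    ∃ J < ℓ, cfc Real.sqrt ((G.induce Γ).lapMatrix ℝ) *ᵥ layer Γ col r u (J + 1) ⬝ᵥ
      layer Γ col r u (J + 1) ≤ 8 * c * M ^ 3 * energy G u := by
  let e (j : ℕ) : ℝ := cycleEnergy fun i => u (r i j)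
  obtain ⟨J, hJ, hmin⟩ := Finset.exists_min_image (Finset.range ℓ) e ⟨0, by simpa using hℓ⟩
  have he : 0 ≤ e J := cycleEnergy_nonneg _
  have hsmall : ℓ * e J ≤ 4 * M * energy G u := by
    refine le_trans ?_ (h.sum_cycleEnergy_le u hr)
    simpa using Finset.card_nsmul_le_sum (Finset.range ℓ) e (e J) hmin
  have hkc : (k : ℝ) ≤ 2 * c * ℓ := mod_cast hkc
  refine ⟨J, Finset.mem_range.1 hJ, ?_⟩
  calc _ ≤ k * (M ^ 2 * e J) := h.sqrt_form_boundary_comp_col_le hℓ fun i => u (r i J)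
    _ ≤ (2 * c * ℓ) * (M ^ 2 * e J) := by gcongr
    _ = 2 * c * M ^ 2 * (ℓ * e J) := by ring
    _ ≤ 2 * c * M ^ 2 * (4 * M * energy G u) := by gcongr
    _ = 8 * c * M ^ 3 * energy G u := by ring

theorem sqrt_form_le_energy (hℓ : 0 < ℓ) {c : ℕ} (hkc : k ≤ 2 * c * ℓ) (u : V → ℝ) :
    cfc Real.sqrt ((G.induce Γ).lapMatrix ℝ) *ᵥ Γ.domRestrict u ⬝ᵥ Γ.domRestrict u ≤
      (10 + 8 * c) * M ^ 3 * energy G u := by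
  obtain ⟨r, hr⟩ := h.exists_mem_cell
  obtain ⟨J, hJ, hlast⟩ := h.exists_sqrt_form_layer_le hℓ hkc u hr
  set x := layer Γ col r u
  have htelescope :=
    form_zero_sub_form_le_sum (posSemidef_cfc_sqrt ((G.induce Γ).lapMatrix ℝ)).isHermitian x (J + 1)
  simp only [sqrt_lapMatrix_mulVec_dotProduct_self] at htelescope
  rw [Finset.sum_add_distrib, ← Finset.sum_div, Finset.sum_add_distrib] at htelescope
  have hdiff := h.sum_layer_sub_le hℓ u hr hJ
  have htail : ∑ j ∈ Finset.range (J + 1), energy (G.induce Γ) (x (j + 1)) ≤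
      4 * M ^ 3 * energy G u :=
    (Finset.sum_le_sum_of_subset_of_nonneg (Finset.range_subset_range.2 hJ) fun _ _ _ =>
      energy_nonneg _ _).trans (h.sum_energy_layer_le hℓ u hr)
  have hinit : ∑ j ∈ Finset.range (J + 1), energy (G.induce Γ) (x j) ≤
      energy G u + 4 * M ^ 3 * energy G u := by
    rw [Finset.sum_range_succ']
    have hzero : energy (G.induce Γ) (x 0) ≤ energy G u := energy_induce_domRestrict_le Γ u
    have hsub : ∑ j ∈ Finset.range J, energy (G.induce Γ) (x (j + 1)) ≤
        ∑ j ∈ Finset.range (J + 1), energy (G.induce Γ) (x (j + 1)) :=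
      Finset.sum_le_sum_of_subset_of_nonneg (Finset.range_subset_range.2 J.le_succ) fun _ _ _ =>
        energy_nonneg _ _
    linarith
  have hM : (1 : ℝ) ≤ M := mod_cast h.one_le hℓ
  have hE := energy_nonneg G u
  have hM₂ : (M : ℝ) ^ 2 * energy G u ≤ M ^ 3 * energy G u := by
    gcongr
    norm_num
  have hM₃ : energy G u ≤ M ^ 3 * energy G u := le_mul_of_one_le_left hE (one_le_pow₀ hM)
  change cfc Real.sqrt ((G.induce Γ).lapMatrix ℝ) *ᵥ x 0 ⬝ᵥ x 0 ≤ _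
  linarith

end

end IsLabelling

/-! ### The upper bound -/

theorem energy_add_le {V : Type*} [Fintype V] (G : SimpleGraph V) (u v : V → ℝ) :
    energy G (u + v) ≤ 2 * energy G u + 2 * energy G v := by
  simp only [energy, mul_div_cancel₀ _ (two_ne_zero' ℝ)]
  rw [div_le_iff₀ two_pos, add_mul, Finset.sum_mul, Finset.sum_mul, ← Finset.sum_add_distrib]
  refine Finset.sum_le_sum fun p _ => ?_
  rw [Finset.sum_mul, Finset.sum_mul, ← Finset.sum_add_distrib]
  refine Finset.sum_le_sum fun q _ => ?_
  split_ifs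
  · simp only [Pi.add_apply]
    linarith [sq_nonneg ((u p - u q) - (v p - v q))]
  · simp

theorem energy_le_mul_sum {V : Type*} [Fintype V] {G : SimpleGraph V} {P : V → Prop}
    [DecidablePred P] {u F : V → ℝ} {n : ℕ} (hF : ∀ p, 0 ≤ F p)
    (hconst : ∀ p q, G.Adj p q → ¬P p → u p = u q)
    (hdeg : ∀ p, P p → Finset.card {q | G.Adj p q ∧ P q} ≤ n)
    (hle : ∀ p q, P p → P q → G.Adj p q → (u p - u q) ^ 2 ≤ F p + F q) :
    energy G u ≤ n * ∑ p with P p, F p := by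
  let T (p q : V) : ℝ := if G.Adj p q ∧ P p ∧ P q then F p else 0
  have hT : ∑ p, ∑ q, T p q ≤ n * ∑ p with P p, F p := by
    rw [Finset.mul_sum, Finset.sum_filter]
    refine Finset.sum_le_sum fun p _ => ?_
    split_ifs with hp
    · simp only [T, hp, true_and]
      rw [← Finset.sum_filter, Finset.sum_const, nsmul_eq_mul]
      exact mul_le_mul_of_nonneg_right (mod_cast hdeg p hp) (hF p)
    · simp [T, hp]
  have hedge (p q : V) : (if G.Adj p q then (u p - u q) ^ 2 else 0) ≤ T p q + T q p := by
    by_cases hpq : G.Adj p q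
    · by_cases hp : P p
      · by_cases hq : P q
        · simpa [T, hpq, hpq.symm, hp, hq] using hle p q hp hq hpq
        · simp [T, hpq, hp, hq, hconst q p hpq.symm hq]
      · simp [T, hpq, hp, hconst p q hpq hp]
    · simp [T, hpq, G.adj_comm q p]
  have henergy : 2 * energy G u ≤ ∑ p, ∑ q, (T p q + T q p) := by
    rw [energy, mul_div_cancel₀ _ two_ne_zero]
    exact Finset.sum_le_sum fun p _ => Finset.sum_le_sum fun q _ => hedge p q
  have hcomm : ∑ p, ∑ q, T q p = ∑ p, ∑ q, T p q := Finset.sum_comm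
  simp only [Finset.sum_add_distrib, hcomm] at henergy
  linarith

theorem dotProduct_self_le_sum_sq_sub {W : Type*} [Fintype W] {x : W → ℝ} (hx : ∑ p, x p = 0)
    (a : ℝ) : x ⬝ᵥ x ≤ ∑ p, (x p - a) ^ 2 := by
  have hexpand : ∑ p, (x p - a) ^ 2 = x ⬝ᵥ x - 2 * a * ∑ p, x p + ∑ _p : W, a ^ 2 := by
    rw [dotProduct, Finset.mul_sum, ← Finset.sum_sub_distrib, ← Finset.sum_add_distrib]
    exact Finset.sum_congr rfl fun p _ => by ring
  rw [hexpand, hx, mul_zero, sub_zero]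
  exact le_add_of_nonneg_right (Finset.sum_nonneg fun _ _ => sq_nonneg a)

theorem dotProduct_self_le_card_sq_mul_energy {W : Type*} [Fintype W] {K : SimpleGraph W}
    (hK : K.Preconnected) {x : W → ℝ} (hx : ∑ p, x p = 0) :
    x ⬝ᵥ x ≤ (Nat.card W : ℝ) ^ 2 * energy K x := by
  rcases isEmpty_or_nonempty W with hW | ⟨⟨a⟩⟩
  · simp [dotProduct]
  · calc x ⬝ᵥ x ≤ ∑ p, (x p - x a) ^ 2 := dotProduct_self_le_sum_sq_sub hx (x a)
      _ ≤ ∑ _p : W, (Nat.card W : ℝ) * energy K x :=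
          Finset.sum_le_sum fun p _ => sq_sub_le_card_mul_energy hK x p a
      _ = (Nat.card W : ℝ) ^ 2 * energy K x := by
          rw [Finset.sum_const, Finset.card_univ, nsmul_eq_mul, Nat.card_eq_fintype_card]
          ring

/-- The linear cutoff on `ℓ` rows, equal to `1` on row `0` and to `0` from row `ℓ - 1` on. -/
noncomputable def cutoff (ℓ j : ℕ) : ℝ := ((ℓ - 1 - j : ℕ) : ℝ) / ((ℓ - 1 : ℕ) : ℝ)

theorem cutoff_zero {ℓ : ℕ} (hℓ : 2 ≤ ℓ) : cutoff ℓ 0 = 1 :=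
  div_self (Nat.cast_ne_zero.2 (by omega))

theorem cutoff_eq_zero {ℓ j : ℕ} (hj : ℓ ≤ j + 1) : cutoff ℓ j = 0 := by
  simp [cutoff, show ℓ - 1 - j = 0 by omega]

theorem cutoff_sq_le_one (ℓ j : ℕ) : cutoff ℓ j ^ 2 ≤ 1 := by
  refine pow_le_one₀ (div_nonneg (Nat.cast_nonneg _) (Nat.cast_nonneg _)) ?_
  exact div_le_one_of_le₀ (Nat.cast_le.2 (Nat.sub_le _ _)) (Nat.cast_nonneg _)

theorem cutoff_succ_sub_sq_le {ℓ : ℕ} (hℓ : 2 ≤ ℓ) (j : ℕ) :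
    (cutoff ℓ (j + 1) - cutoff ℓ j) ^ 2 ≤ 4 / (ℓ : ℝ) ^ 2 := by
  have hpos : (0 : ℝ) < ((ℓ - 1 : ℕ) : ℝ) := Nat.cast_pos.2 (by omega)
  have _ : (0 : ℝ) < ℓ := Nat.cast_pos.2 (by omega)
  have hhalf : (ℓ : ℝ) ≤ 2 * ((ℓ - 1 : ℕ) : ℝ) := mod_cast show ℓ ≤ 2 * (ℓ - 1) by omega
  have hstep : (((ℓ - 1 - (j + 1) : ℕ) : ℝ) - ((ℓ - 1 - j : ℕ) : ℝ)) ^ 2 ≤ 1 := by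
    rcases Nat.lt_or_ge j (ℓ - 1) with hj | hj
    · rw [show ℓ - 1 - j = ℓ - 1 - (j + 1) + 1 by omega]
      push_cast
      ring_nf
      rfl
    · simp [show ℓ - 1 - j = 0 by omega, show ℓ - 1 - (j + 1) = 0 by omega]
  rw [cutoff, cutoff, ← sub_div, div_pow, div_le_div_iff₀ (by positivity) (by positivity)]
  calc _ ≤ 1 * (2 * ((ℓ - 1 : ℕ) : ℝ)) ^ 2 := by gcongr
    _ = 4 * ((ℓ - 1 : ℕ) : ℝ) ^ 2 := by ring

theorem Near.mem {k : ℕ} [NeZero k] {i i' : Fin k} (h : Near i i') :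
    i' ∈ ({i, i + 1, i - 1} : Finset (Fin k)) := by
  rcases h with h | h | h <;> simp [h]

/-- The boundary vertices in the columns `i` and `i + 1`. -/
def window {V : Type*} {k : ℕ} [NeZero k] (Γ : Set V) (col : V → Fin k) (i : Fin k) : Set Γ :=
  {p | col p = i ∨ col p = i + 1}

namespace IsLabelling

variable {V : Type*} {G : SimpleGraph V} {Γ : Set V} {k ℓ M : ℕ} [NeZero k]
  {col : V → Fin k} {row : V → ℕ} (h : IsLabelling G Γ k ℓ M col row)
include h

theorem preconnected_boundary
    (hconn : ∀ i, ((G.induce Γ).induce (window Γ col i)).Preconnected) :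
    (G.induce Γ).Preconnected := by
  have hwindow {i : Fin k} {p q : Γ} (hp : p ∈ window Γ col i) (hq : q ∈ window Γ col i) :
      (G.induce Γ).Reachable p q :=
    (hconn i ⟨p, hp⟩ ⟨q, hq⟩).map (Embedding.induce _).toHom
  have hreach (n : ℕ) : ∀ p q : Γ, col q = col p + Fin.ofNat k n → (G.induce Γ).Reachable p q := by
    induction n with
    | zero =>
      intro p q hq
      exact hwindow (Or.inl rfl) (Or.inl (hq.trans (add_zero _)))
    | succ n ih =>
      intro p q hq
      obtain ⟨r, hr, hcol⟩ := h.boundary_col (col p + Fin.ofNat k n)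
      refine (ih p ⟨r, hr⟩ hcol).trans (hwindow (Or.inl rfl) (Or.inr ?_))
      rw [hq, hcol, add_assoc]
      congr 1
      ext
      simp [Fin.val_add]
  intro p q
  refine hreach (col q - col p : Fin k) p q ?_
  simp

theorem card_boundary_le [Finite V] (hℓ : 0 < ℓ) : (Nat.card Γ : ℝ) ≤ k * M := by
  have := Fintype.ofFinite V
  simpa [mul_comm] using h.sum_boundary_comp_col_le hℓ (f := fun _ => 1) fun _ => zero_le_one

theorem ncard_window_le [Finite V] (hℓ : 0 < ℓ) (i : Fin k) :
    (window Γ col i).ncard ≤ 2 * M := by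
  have := Fintype.ofFinite V
  rw [Set.ncard_eq_toFinset_card']
  refine (Finset.card_le_card (t := Finset.univ.filter (fun p : Γ => col p = i) ∪
    Finset.univ.filter fun p : Γ => col p = i + 1) fun p hp => ?_).trans <|
    (Finset.card_union_le _ _).trans ?_
  · rcases Set.mem_toFinset.1 hp with hp | hp <;> simp [hp]
  · linarith [h.card_boundary_col_le hℓ i, h.card_boundary_col_le hℓ (i + 1)]

variable [Fintype V]

theorem card_neighbors_le {p : V} (hp : row p < ℓ) :
    Finset.card {q | G.Adj p q ∧ row q < ℓ} ≤ 9 * M := by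
  let I : Finset (Fin k × ℕ) := {col p, col p + 1, col p - 1} ×ˢ {row p, row p + 1, row p - 1}
  have hI : I.card ≤ 9 := by
    rw [Finset.card_product]
    exact Nat.mul_le_mul Finset.card_le_three Finset.card_le_three
  have hmaps (q : V) (hq : q ∈ Finset.univ.filter fun q => G.Adj p q ∧ row q < ℓ) :
      (col q, row q) ∈ I := by
    obtain ⟨hpq, hq⟩ := (Finset.mem_filter.1 hq).2
    refine Finset.mem_product.2 ⟨(h.near hpq hp hq).mem, ?_⟩
    have hle := h.row_le hpq hp hq
    have hge := h.row_le hpq.symm hq hp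
    simp only [Finset.mem_insert, Finset.mem_singleton]
    omega
  refine (Finset.card_le_mul_card_image_of_maps_to hmaps M fun x _ => ?_).trans
    ((Nat.mul_le_mul_left M hI).trans_eq (Nat.mul_comm _ _))
  rw [Finset.filter_filter]
  by_cases hx : x.2 < ℓ
  · refine le_trans ?_ (h.ncard_le x.1 x.2 hx)
    rw [Set.ncard_eq_toFinset_card']
    refine Finset.card_le_card fun q hq => Set.mem_toFinset.2 ?_
    exact Prod.ext_iff.1 (Finset.mem_filter.1 hq).2.2
  · rw [Finset.card_eq_zero.2]
    · exact Nat.zero_le _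
    · refine Finset.filter_eq_empty_iff.2 ?_
      rintro q - ⟨⟨-, hq⟩, rfl⟩
      exact hx hq

theorem card_boundary_neighbors_le (hℓ : 0 < ℓ) (p : Γ) :
    Finset.card {q | (G.induce Γ).Adj p q} ≤ 3 * M := by
  refine (Finset.card_le_mul_card_image_of_maps_to (f := fun q : Γ => col q)
    (t := {col p, col p + 1, col p - 1}) (fun q hq => ?_) M fun i _ => ?_).trans
    ((Nat.mul_le_mul_left M Finset.card_le_three).trans_eq (Nat.mul_comm _ _))
  · exact (h.near_boundary hℓ (Finset.mem_filter.1 hq).2).mem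
  · exact (Finset.card_le_card (Finset.filter_subset_filter _ (Finset.subset_univ _))).trans
      (h.card_boundary_col_le hℓ i)

theorem energy_boundary_le_mul_dotProduct (hℓ : 0 < ℓ) (x : Γ → ℝ) :
    energy (G.induce Γ) x ≤ 6 * M * (x ⬝ᵥ x) := by
  refine (energy_le_mul_sum (P := fun _ => True) (F := fun p => 2 * x p ^ 2) (n := 3 * M)
    (fun p => by positivity) (fun p q _ hp => absurd trivial hp) (fun p _ => ?_)
    fun p q _ _ _ => by linarith [sq_nonneg (x p + x q)]).trans_eq ?_
  · simpa using h.card_boundary_neighbors_le hℓ p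
  · simp only [Finset.filter_true, ← Finset.mul_sum, dotProduct, ← sq]
    push_cast
    ring

theorem sum_rows_le {f : Fin k → ℕ → ℝ} (hf : ∀ i j, 0 ≤ f i j) :
    ∑ p with row p < ℓ, f (col p) (row p) ≤ M * ∑ j ∈ Finset.range ℓ, ∑ i, f i j := by
  have hmaps (p : V) (hp : p ∈ Finset.univ.filter fun p => row p < ℓ) :
      (row p, col p) ∈ Finset.range ℓ ×ˢ Finset.univ := by simpa using hp
  rw [← Finset.sum_product', Finset.mul_sum,
    ← Finset.sum_fiberwise_of_maps_to' hmaps fun x => f x.2 x.1]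
  refine Finset.sum_le_sum fun x hx => ?_
  rw [Finset.sum_const, nsmul_eq_mul]
  refine mul_le_mul_of_nonneg_right (Nat.cast_le.2 ?_) (hf _ _)
  refine le_trans ?_ (h.ncard_le x.2 x.1 (Finset.mem_range.1 (Finset.mem_product.1 hx).1))
  rw [Set.ncard_eq_toFinset_card']
  refine Finset.card_le_card fun p hp => Set.mem_toFinset.2 ?_
  exact (Prod.ext_iff.1 (Finset.mem_filter.1 hp).2).symm

theorem cycleEnergy_boundary_le (hℓ : 0 < ℓ)
    (hconn : ∀ i, ((G.induce Γ).induce (window Γ col i)).Preconnected) {β : Fin k → Γ}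
    (hβ : ∀ i, col (β i) = i) (x : Γ → ℝ) :
    cycleEnergy (fun i => x (β i)) ≤ 4 * M * energy (G.induce Γ) x := by
  have hmult (p : Γ) : Finset.card {i | p ∈ window Γ col i} ≤ 2 := by
    refine (Finset.card_le_card (t := {(col p), (col p - 1)}) fun i hi => ?_).trans
      Finset.card_le_two
    rcases (Finset.mem_filter.1 hi).2 with hi | hi <;> simp [hi]
  refine (sum_sq_sub_le_mul_energy hconn (h.ncard_window_le hℓ) (fun p => by convert hmult p) x
    (p := fun i => β (i + 1)) (q := β) (fun i => Or.inr (hβ _)) fun i => Or.inl (hβ i)).trans_eq ?_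
  push_cast
  ring

theorem sum_sq_sub_boundary_le (hℓ : 0 < ℓ)
    (hconn : ∀ i, ((G.induce Γ).induce (window Γ col i)).Preconnected) {β : Fin k → Γ}
    (hβ : ∀ i, col (β i) = i) (x : Γ → ℝ) :
    ∑ p : Γ, (x p - x (β (col p))) ^ 2 ≤ 4 * M ^ 2 * energy (G.induce Γ) x := by
  have hmult (q : Γ) : Finset.card {p : Γ | q ∈ window Γ col (col p)} ≤ 2 * M := by
    refine (Finset.card_le_card (t := Finset.univ.filter (fun p : Γ => col p = col q) ∪
      Finset.univ.filter fun p : Γ => col p = col q - 1) fun p hp => ?_).trans <|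
      (Finset.card_union_le _ _).trans ?_
    · rcases (Finset.mem_filter.1 hp).2 with hp | hp <;> simp [hp]
    · linarith [h.card_boundary_col_le hℓ (col q), h.card_boundary_col_le hℓ (col q - 1)]
  refine (sum_sq_sub_le_mul_energy (fun p : Γ => hconn (col p))
    (fun p => h.ncard_window_le hℓ (col p)) (fun p => by convert hmult p) x
    (p := fun p => p) (q := fun p => β (col p)) (fun p => Or.inl rfl)
    fun p => Or.inl (hβ _)).trans_eq ?_
  push_cast
  ring

end IsLabelling

/-- The sum of the squared increments of `U` on the edges of the annulus along which an edge of `G`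
with lower end in column `i` and row `j` can be rerouted. -/
def increments {k : ℕ} [NeZero k] (U : Fin k → ℕ → ℝ) (i : Fin k) (j : ℕ) : ℝ :=
  (U (i + 1) j - U i j) ^ 2 + (U i j - U (i - 1) j) ^ 2 + (U i (j + 1) - U i j) ^ 2 +
    (U (i + 1) (j + 1) - U (i + 1) j) ^ 2 + (U (i - 1) (j + 1) - U (i - 1) j) ^ 2

section Increments

variable {k : ℕ} [NeZero k] (U : Fin k → ℕ → ℝ)

theorem increments_nonneg (i : Fin k) (j : ℕ) : 0 ≤ increments U i j := by
  unfold increments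
  positivity

theorem sum_increments (j : ℕ) :
    ∑ i, increments U i j =
      2 * cycleEnergy (fun i => U i j) + 3 * ∑ i, (U i (j + 1) - U i j) ^ 2 := by
  have hprev : ∑ i, (U i j - U (i - 1) j) ^ 2 = ∑ i, (U (i + 1) j - U i j) ^ 2 := by
    simpa using (Equiv.subRight (1 : Fin k)).sum_comp fun i => (U (i + 1) j - U i j) ^ 2
  have hsucc_up := Equiv.sum_comp (Equiv.addRight (1 : Fin k)) fun i => (U i (j + 1) - U i j) ^ 2
  have hprev_up := (Equiv.subRight (1 : Fin k)).sum_comp fun i => (U i (j + 1) - U i j) ^ 2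
  simp only [Equiv.coe_addRight, Equiv.subRight_apply] at hsucc_up hprev_up
  simp only [increments, Finset.sum_add_distrib, cycleEnergy, hprev, hsucc_up, hprev_up]
  ring

variable {U} {i i' : Fin k}

theorem Near.sq_sub_le_increments (h : Near i i') (j : ℕ) :
    (U i j - U i' j) ^ 2 ≤ 2 * increments U i j := by
  have hnonneg := increments_nonneg U i j
  rcases h with rfl | rfl | rfl
  · simpa using hnonneg
  · rw [sub_sq_comm]
    unfold increments at hnonneg ⊢
    nlinarith
  · unfold increments at hnonneg ⊢
    simp only [add_sub_cancel_right] at hnonneg ⊢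
    nlinarith

theorem Near.sq_sub_succ_le_increments (h : Near i i') (j : ℕ) :
    (U i j - U i' (j + 1)) ^ 2 ≤ 2 * increments U i j := by
  have hsplit : (U i j - U i' (j + 1)) ^ 2 ≤
      2 * (U i' j - U i j) ^ 2 + 2 * (U i' (j + 1) - U i' j) ^ 2 := by
    linarith [sq_nonneg ((U i' j - U i j) - (U i' (j + 1) - U i' j))]
  refine hsplit.trans ?_
  rw [← mul_add]
  gcongr
  unfold increments
  rcases h with rfl | rfl | rfl
  · rw [sub_self]
    nlinarith
  · nlinarith
  · simp only [add_sub_cancel_right, sub_sq_comm (U i' j)]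
    nlinarith

end Increments

/-- The function on the annulus that interpolates from `m + v 0` on row `0` to the constant `m` on
the last row, following the values of `v j` at one representative `β i` of each column. -/
noncomputable def profile {W : Type*} {k : ℕ} (ℓ : ℕ) (m : ℝ) (v : ℕ → W → ℝ) (β : Fin k → W)
    (i : Fin k) (j : ℕ) : ℝ :=
  m + cutoff ℓ j * v j (β i)

section Profile

variable {W : Type*} {k ℓ : ℕ} (m : ℝ) (v : ℕ → W → ℝ) {β : Fin k → W}

theorem cycleEnergy_profile_le [NeZero k] (j : ℕ) :
    cycleEnergy (fun i => profile ℓ m v β i j) ≤ cycleEnergy fun i => v j (β i) := by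
  refine Finset.sum_le_sum fun i _ => ?_
  calc (profile ℓ m v β (i + 1) j - profile ℓ m v β i j) ^ 2
      = cutoff ℓ j ^ 2 * (v j (β (i + 1)) - v j (β i)) ^ 2 := by
        simp only [profile]
        ring
    _ ≤ (v j (β (i + 1)) - v j (β i)) ^ 2 :=
        mul_le_of_le_one_left (sq_nonneg _) (cutoff_sq_le_one ℓ j)

theorem sum_sq_comp_le_dotProduct [Fintype W] (hβ : Function.Injective β) (x : W → ℝ) :
    ∑ i, x (β i) ^ 2 ≤ x ⬝ᵥ x := by
  simp only [dotProduct, ← sq]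
  rw [← Finset.sum_image (f := fun p => x p ^ 2) (s := Finset.univ) hβ.injOn]
  exact Finset.sum_le_sum_of_subset_of_nonneg (Finset.subset_univ _) fun _ _ _ => sq_nonneg _

theorem sum_sq_profile_succ_sub_le [Fintype W] (hℓ : 2 ≤ ℓ) (hβ : Function.Injective β) (j : ℕ) :
    ∑ i, (profile ℓ m v β i (j + 1) - profile ℓ m v β i j) ^ 2 ≤
      2 * ((v (j + 1) - v j) ⬝ᵥ (v (j + 1) - v j)) + 8 / (ℓ : ℝ) ^ 2 * (v j ⬝ᵥ v j) := by
  have hcolumn (i : Fin k) : (profile ℓ m v β i (j + 1) - profile ℓ m v β i j) ^ 2 ≤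
      2 * (v (j + 1) - v j) (β i) ^ 2 + 8 / (ℓ : ℝ) ^ 2 * v j (β i) ^ 2 := by
    set y := (v (j + 1) - v j) (β i) with hy
    set z := v j (β i)
    have hcutoff := mul_le_of_le_one_left (sq_nonneg y) (cutoff_sq_le_one ℓ (j + 1))
    have hslope := mul_le_mul_of_nonneg_right (cutoff_succ_sub_sq_le hℓ j) (sq_nonneg z)
    calc _ = (cutoff ℓ (j + 1) * y + (cutoff ℓ (j + 1) - cutoff ℓ j) * z) ^ 2 := by
          simp only [profile, hy, z, Pi.sub_apply]
          ring
      _ ≤ 2 * (cutoff ℓ (j + 1) ^ 2 * y ^ 2) +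
            2 * ((cutoff ℓ (j + 1) - cutoff ℓ j) ^ 2 * z ^ 2) := by
          simpa only [mul_pow, mul_add] using add_sq_le (a := cutoff ℓ (j + 1) * y)
            (b := (cutoff ℓ (j + 1) - cutoff ℓ j) * z)
      _ ≤ 2 * y ^ 2 + 2 * (4 / (ℓ : ℝ) ^ 2 * z ^ 2) := by gcongr
      _ = 2 * y ^ 2 + 8 / (ℓ : ℝ) ^ 2 * z ^ 2 := by ring
  refine (Finset.sum_le_sum fun i _ => hcolumn i).trans ?_
  rw [Finset.sum_add_distrib, ← Finset.mul_sum, ← Finset.mul_sum]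
  gcongr <;> exact sum_sq_comp_le_dotProduct hβ _

end Profile

namespace IsLabelling

variable {V : Type*} {G : SimpleGraph V} {Γ : Set V} {k ℓ M : ℕ} [NeZero k]
  {col : V → Fin k} {row : V → ℕ} (h : IsLabelling G Γ k ℓ M col row)
include h

theorem sq_sub_le_increments {p q : V} (hpq : G.Adj p q) (hp : row p < ℓ) (hq : row q < ℓ)
    (U : Fin k → ℕ → ℝ) :
    (U (col p) (row p) - U (col q) (row q)) ^ 2 ≤
      2 * increments U (col p) (row p) + 2 * increments U (col q) (row q) := by
  have hnear := h.near hpq hp hq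
  have hp_nonneg := increments_nonneg U (col p) (row p)
  have hq_nonneg := increments_nonneg U (col q) (row q)
  have hrow : row q = row p ∨ row q = row p + 1 ∨ row p = row q + 1 := by
    have hle := h.row_le hpq hp hq
    have hge := h.row_le hpq.symm hq hp
    omega
  rcases hrow with hrow | hrow | hrow
  · rw [hrow] at hq_nonneg ⊢
    linarith [hnear.sq_sub_le_increments (U := U) (row p)]
  · have hup := hnear.sq_sub_succ_le_increments (U := U) (row p)
    rw [← hrow] at hup
    linarith
  · have hup := hnear.symm.sq_sub_succ_le_increments (U := U) (row q)
    rw [← hrow, sub_sq_comm] at hup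
    linarith

theorem le_row_add_one {p q : V} (hpq : G.Adj p q) (hp : ℓ ≤ row p) : ℓ ≤ row q + 1 := by
  rcases Nat.lt_or_ge (row q) ℓ with hq | hq
  · exact (h.last_row hpq.symm hq hp).ge
  · exact hq.trans (Nat.le_succ _)

variable [Fintype V]

theorem energy_comp_label_le {U : Fin k → ℕ → ℝ} {m : ℝ} (hU : ∀ i j, ℓ ≤ j + 1 → U i j = m) :
    energy G (fun p => U (col p) (row p)) ≤ 18 * M ^ 2 * ∑ j ∈ Finset.range ℓ,
      (2 * cycleEnergy (fun i => U i j) + 3 * ∑ i, (U i (j + 1) - U i j) ^ 2) := by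
  have hconst (p q : V) (hpq : G.Adj p q) (hp : ¬row p < ℓ) :
      U (col p) (row p) = U (col q) (row q) := by
    have hp : ℓ ≤ row p := not_lt.1 hp
    rw [hU _ _ (hp.trans (Nat.le_succ _)), hU _ _ (h.le_row_add_one hpq hp)]
  have hnonneg (p : V) : 0 ≤ 2 * increments U (col p) (row p) :=
    mul_nonneg zero_le_two (increments_nonneg U _ _)
  calc energy G (fun p => U (col p) (row p))
      ≤ (9 * M : ℕ) * ∑ p with row p < ℓ, 2 * increments U (col p) (row p) :=
        energy_le_mul_sum hnonneg hconst (fun p hp => h.card_neighbors_le hp)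
          fun p q hp hq hpq => h.sq_sub_le_increments hpq hp hq U
    _ ≤ (9 * M : ℕ) * (2 * (M * ∑ j ∈ Finset.range ℓ, ∑ i, increments U i j)) := by
        rw [← Finset.mul_sum]
        gcongr
        exact h.sum_rows_le (increments_nonneg U)
    _ = _ := by
        simp only [sum_increments]
        push_cast
        ring

theorem energy_le_mul_sum_boundary (hℓ : 2 ≤ ℓ) {ε : V → ℝ} (hε : ∀ p ∉ Γ, ε p = 0) :
    energy G ε ≤ 18 * M * ∑ p : Γ, ε p ^ 2 := by
  have hrow (p : V) (hp : 0 < row p) : ε p = 0 :=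
    hε p fun hpΓ => hp.ne' (h.boundary_row p hpΓ)
  have hconst (p q : V) (hpq : G.Adj p q) (hp : ¬row p < ℓ) : ε p = ε q := by
    have hp : ℓ ≤ row p := not_lt.1 hp
    have hq := h.le_row_add_one hpq hp
    rw [hrow p (by omega), hrow q (by omega)]
  calc energy G ε ≤ (9 * M : ℕ) * ∑ p with row p < ℓ, 2 * ε p ^ 2 :=
        energy_le_mul_sum (fun p => by positivity) hconst (fun p hp => h.card_neighbors_le hp)
          fun p q _ _ _ => by linarith [sq_nonneg (ε p + ε q)]
    _ ≤ (9 * M : ℕ) * ∑ p, 2 * ε p ^ 2 := by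
        gcongr
        exact Finset.subset_univ _
    _ = 18 * M * ∑ p : Γ, ε p ^ 2 := by
        have hinterior : ∑ p : {p // p ∉ Γ}, ε p ^ 2 = 0 :=
          Finset.sum_eq_zero fun p _ => by simp [hε p p.2]
        rw [← Finset.mul_sum, ← Fintype.sum_subtype_add_sum_subtype (· ∈ Γ), hinterior]
        push_cast
        ring

theorem exists_extension_energy_le (hℓ : 2 ≤ ℓ)
    (hconn : ∀ i, ((G.induce Γ).induce (window Γ col i)).Preconnected) {φ : Γ → ℝ} {m : ℝ}
    {v : ℕ → Γ → ℝ} (hv : v 0 = φ - fun _ => m) :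
    ∃ u : V → ℝ, Γ.domRestrict u = φ ∧ energy G u ≤ 144 * M ^ 3 * energy (G.induce Γ) φ +
      288 * M ^ 3 * ∑ j ∈ Finset.range ℓ, energy (G.induce Γ) (v j) +
      108 * M ^ 2 * ∑ j ∈ Finset.range ℓ, (2 * ((v (j + 1) - v j) ⬝ᵥ (v (j + 1) - v j)) +
        8 / (ℓ : ℝ) ^ 2 * (v j ⬝ᵥ v j)) := by
  have hℓ₀ : 0 < ℓ := by omega
  choose b hbΓ hb using h.boundary_col
  let β (i : Fin k) : Γ := ⟨b i, hbΓ i⟩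
  have hβ_inj : Function.Injective β :=
    Function.LeftInverse.injective (g := fun p : Γ => col p) hb
  let U := profile ℓ m v β
  let ε (p : V) : ℝ := if hp : p ∈ Γ then φ ⟨p, hp⟩ - φ (β (col p)) else 0
  have hU := h.energy_comp_label_le (U := U) (m := m) fun i j hj => by
    simp [U, profile, cutoff_eq_zero hj]
  have hε := h.energy_le_mul_sum_boundary (ε := ε) hℓ fun p hp => dif_neg hp
  have hε_sum : ∑ p : Γ, ε p ^ 2 ≤ 4 * M ^ 2 * energy (G.induce Γ) φ := by
    simpa [ε] using h.sum_sq_sub_boundary_le hℓ₀ hconn (β := β) hb φ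
  have hcycle (j : ℕ) : cycleEnergy (fun i => U i j) ≤ 4 * M * energy (G.induce Γ) (v j) :=
    (cycleEnergy_profile_le m v j).trans (h.cycleEnergy_boundary_le hℓ₀ hconn hb (v j))
  refine ⟨(fun p => U (col p) (row p)) + ε, ?_, ?_⟩
  · ext p
    simp [U, ε, profile, h.boundary_row p p.2, cutoff_zero hℓ, hv]
  · calc _ ≤ 2 * (18 * M ^ 2 * ∑ j ∈ Finset.range ℓ,
            (2 * (4 * M * energy (G.induce Γ) (v j)) +
              3 * (2 * ((v (j + 1) - v j) ⬝ᵥ (v (j + 1) - v j)) +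
                8 / (ℓ : ℝ) ^ 2 * (v j ⬝ᵥ v j)))) +
            2 * (18 * M * (4 * M ^ 2 * energy (G.induce Γ) φ)) := by
          refine (energy_add_le G _ _).trans ?_
          gcongr
          · refine hU.trans ?_
            gcongr with j
            · exact hcycle j
            · exact sum_sq_profile_succ_sub_le m v hℓ hβ_inj j
          · refine hε.trans ?_
            gcongr
      _ = _ := by
          rw [Finset.sum_add_distrib, ← Finset.mul_sum, ← Finset.mul_sum, ← Finset.mul_sum]
          ring

end IsLabelling

theorem mulVec_sub_const_dotProduct_self {W : Type*} [Fintype W] {B : Matrix W W ℝ}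
    (hB : B.IsHermitian) {a : ℝ} (ha : B *ᵥ (fun _ => a) = 0) (x : W → ℝ) :
    B *ᵥ (x - fun _ => a) ⬝ᵥ (x - fun _ => a) = B *ᵥ x ⬝ᵥ x := by
  rw [mulVec_sub, ha, sub_zero, dotProduct_sub, mulVec_dotProduct_comm hB x (fun _ => a), ha,
    zero_dotProduct, sub_zero]

theorem exists_sum_sub_const_eq_zero {W : Type*} [Fintype W] (x : W → ℝ) :
    ∃ a : ℝ, ∑ p, (x - fun _ => a : W → ℝ) p = 0 := by
  refine ⟨(∑ p, x p) / Fintype.card W, ?_⟩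
  rcases isEmpty_or_nonempty W with hW | hW
  · simp
  · have hcard : (Fintype.card W : ℝ) ≠ 0 := by positivity
    simp [mul_div_cancel₀ _ hcard]

theorem descent_succ_sub_dotProduct_self {W : Type*} [Fintype W] (B : Matrix W W ℝ) (τ : ℝ)
    (x : W → ℝ) (j : ℕ) :
    (descent B τ x (j + 1) - descent B τ x j) ⬝ᵥ (descent B τ x (j + 1) - descent B τ x j) =
      τ ^ 2 * (B *ᵥ descent B τ x j ⬝ᵥ B *ᵥ descent B τ x j) := by
  rw [descent_succ, sub_sub_cancel_left, neg_dotProduct_neg, smul_dotProduct, dotProduct_smul,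
    smul_eq_mul, smul_eq_mul, sq, mul_assoc]

namespace IsLabelling

variable {V : Type*} [Fintype V] {G : SimpleGraph V} {Γ : Set V} {k ℓ M : ℕ} [NeZero k]
  {col : V → Fin k} {row : V → ℕ} (h : IsLabelling G Γ k ℓ M col row)
include h

theorem sqrt_mulVec_dotProduct_self_le (hℓ : 0 < ℓ) (x : Γ → ℝ) :
    (1 / (3 * M : ℝ)) ^ 2 * (cfc Real.sqrt ((G.induce Γ).lapMatrix ℝ) *ᵥ x ⬝ᵥ
      cfc Real.sqrt ((G.induce Γ).lapMatrix ℝ) *ᵥ x) ≤ x ⬝ᵥ x := by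
  have hM : (1 : ℝ) ≤ M := mod_cast h.one_le hℓ
  have hx : 0 ≤ x ⬝ᵥ x := dotProduct_star_self_nonneg x
  rw [sqrt_lapMatrix_mulVec_dotProduct_self, div_pow, one_pow, one_div_mul_eq_div,
    div_le_iff₀ (by positivity), mul_comm]
  refine (h.energy_boundary_le_mul_dotProduct hℓ x).trans ?_
  gcongr
  nlinarith

theorem dotProduct_self_le_sqrt_form (hℓ : 0 < ℓ)
    (hconn : ∀ i, ((G.induce Γ).induce (window Γ col i)).Preconnected) {x : Γ → ℝ}
    (hx : ∑ p, x p = 0) :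
    x ⬝ᵥ x ≤ k * M * (cfc Real.sqrt ((G.induce Γ).lapMatrix ℝ) *ᵥ x ⬝ᵥ x) := by
  set B := cfc Real.sqrt ((G.induce Γ).lapMatrix ℝ)
  have hB : B.PosSemidef := posSemidef_cfc_sqrt _
  have hone : B *ᵥ (fun _ => 1) = 0 := sqrt_lapMatrix_mulVec_const _ 1
  have hk : (0 : ℝ) < k := Nat.cast_pos.2 (NeZero.pos k)
  have hM : (0 : ℝ) < M := Nat.cast_pos.2 (h.one_le hℓ)
  let S : Submodule ℝ (Γ → ℝ) := LinearMap.ker (∑ p, LinearMap.proj (R := ℝ) (φ := fun _ => ℝ) p)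
  have hS (y : Γ → ℝ) : y ∈ S ↔ ∑ p, y p = 0 := by simp [S]
  refine dotProduct_self_le_mul_form hB (S := S) (fun y _ => ?_) (by positivity) (fun y hy => ?_)
    ((hS x).2 hx)
  · rw [hS]
    simpa [dotProduct, hone] using mulVec_dotProduct_comm hB.isHermitian y fun _ => 1
  · refine (dotProduct_self_le_card_sq_mul_energy (h.preconnected_boundary hconn)
      ((hS y).1 hy)).trans ?_
    rw [sqrt_lapMatrix_mulVec_dotProduct_self]
    have _ := energy_nonneg (G.induce Γ) y
    gcongr
    exact h.card_boundary_le hℓ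

theorem sum_energy_descent_le (hℓ : 0 < ℓ) (x : Γ → ℝ) (n : ℕ) :
    ∑ j ∈ Finset.range n, energy (G.induce Γ)
      (descent (cfc Real.sqrt ((G.induce Γ).lapMatrix ℝ)) (1 / (3 * M)) x j) ≤
      3 * M * (cfc Real.sqrt ((G.induce Γ).lapMatrix ℝ) *ᵥ x ⬝ᵥ x) := by
  have hM : (0 : ℝ) < M := Nat.cast_pos.2 (h.one_le hℓ)
  have hsum := mul_sum_descent_le (posSemidef_cfc_sqrt _) (by positivity)
    (h.sqrt_mulVec_dotProduct_self_le hℓ) x n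
  simp only [sqrt_lapMatrix_mulVec_dotProduct_self] at hsum
  rwa [one_div_mul_eq_div, div_le_iff₀' (by positivity)] at hsum

theorem energy_boundary_le_sqrt_form (hℓ : 0 < ℓ) (x : Γ → ℝ) :
    energy (G.induce Γ) x ≤ 3 * M * (cfc Real.sqrt ((G.induce Γ).lapMatrix ℝ) *ᵥ x ⬝ᵥ x) := by
  simpa [descent] using h.sum_energy_descent_le hℓ x 1

theorem sum_descent_succ_sub_le (hℓ : 0 < ℓ) (x : Γ → ℝ) (n : ℕ) {v : ℕ → Γ → ℝ}
    (hv : v = descent (cfc Real.sqrt ((G.induce Γ).lapMatrix ℝ)) (1 / (3 * M)) x) :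
    ∑ j ∈ Finset.range n, (v (j + 1) - v j) ⬝ᵥ (v (j + 1) - v j) ≤
      cfc Real.sqrt ((G.induce Γ).lapMatrix ℝ) *ᵥ x ⬝ᵥ x / 3 := by
  have hM : (1 : ℝ) ≤ M := mod_cast h.one_le hℓ
  have hform := mulVec_dotProduct_self_nonneg
    (posSemidef_cfc_sqrt ((G.induce Γ).lapMatrix ℝ)) x
  have hsum := h.sum_energy_descent_le hℓ x n
  subst hv
  simp only [descent_succ_sub_dotProduct_self, sqrt_lapMatrix_mulVec_dotProduct_self,
    ← Finset.mul_sum]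
  set Q := cfc Real.sqrt ((G.induce Γ).lapMatrix ℝ) *ᵥ x ⬝ᵥ x
  calc _ ≤ (1 / (3 * M : ℝ)) ^ 2 * (3 * M * Q) := by gcongr
    _ = Q / 3 / M := by field_simp
    _ ≤ Q / 3 := div_le_self (by positivity) hM

theorem sum_descent_dotProduct_self_le (hℓ : 0 < ℓ) {c : ℕ} (hkc : k ≤ 2 * c * ℓ)
    (hconn : ∀ i, ((G.induce Γ).induce (window Γ col i)).Preconnected) {x : Γ → ℝ}
    (hx : ∑ p, x p = 0) {v : ℕ → Γ → ℝ}
    (hv : v = descent (cfc Real.sqrt ((G.induce Γ).lapMatrix ℝ)) (1 / (3 * M)) x) :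
    ∑ j ∈ Finset.range ℓ, v j ⬝ᵥ v j ≤
      2 * c * ℓ ^ 2 * M * (cfc Real.sqrt ((G.induce Γ).lapMatrix ℝ) *ᵥ x ⬝ᵥ x) := by
  have hform := mulVec_dotProduct_self_nonneg
    (posSemidef_cfc_sqrt ((G.induce Γ).lapMatrix ℝ)) x
  have hgap := h.dotProduct_self_le_sqrt_form hℓ hconn hx
  have hkc : (k : ℝ) ≤ 2 * c * ℓ := mod_cast hkc
  subst hv
  calc _ ≤ ∑ _j ∈ Finset.range ℓ, x ⬝ᵥ x :=
        Finset.sum_le_sum fun j _ => dotProduct_descent_le (posSemidef_cfc_sqrt _)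
          (by positivity) (h.sqrt_mulVec_dotProduct_self_le hℓ) x j
    _ = ℓ * (x ⬝ᵥ x) := by rw [Finset.sum_const, Finset.card_range, nsmul_eq_mul]
    _ ≤ ℓ * (2 * c * ℓ * M * (cfc Real.sqrt ((G.induce Γ).lapMatrix ℝ) *ᵥ x ⬝ᵥ x)) := by
        refine mul_le_mul_of_nonneg_left (hgap.trans ?_) (Nat.cast_nonneg ℓ)
        gcongr
    _ = _ := by ring

theorem exists_extension_energy_le_sqrt_form (hℓ : 2 ≤ ℓ) {c : ℕ} (hkc : k ≤ 2 * c * ℓ)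
    (hconn : ∀ i, ((G.induce Γ).induce (window Γ col i)).Preconnected) (φ : Γ → ℝ) :
    ∃ u : V → ℝ, Γ.domRestrict u = φ ∧ energy G u ≤
      72 * (24 * c + 19) * M ^ 4 * (cfc Real.sqrt ((G.induce Γ).lapMatrix ℝ) *ᵥ φ ⬝ᵥ φ) := by
  have hℓ₀ : 0 < ℓ := by omega
  have hM : (1 : ℝ) ≤ M := mod_cast h.one_le hℓ₀
  set B := cfc Real.sqrt ((G.induce Γ).lapMatrix ℝ)
  have hB : B.PosSemidef := posSemidef_cfc_sqrt _
  set Q := B *ᵥ φ ⬝ᵥ φ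
  have hQ : 0 ≤ Q := mulVec_dotProduct_self_nonneg hB φ
  obtain ⟨m, hm⟩ := exists_sum_sub_const_eq_zero φ
  have hform : B *ᵥ (φ - fun _ => m) ⬝ᵥ (φ - fun _ => m) = Q :=
    mulVec_sub_const_dotProduct_self hB.isHermitian (sqrt_lapMatrix_mulVec_const _ m) φ
  obtain ⟨v, hv⟩ : ∃ v, v = descent B (1 / (3 * M)) (φ - fun _ => m) := ⟨_, rfl⟩
  have henergy := h.sum_energy_descent_le hℓ₀ (φ - fun _ => m) ℓ
  have hstep := h.sum_descent_succ_sub_le hℓ₀ (φ - fun _ => m) ℓ hv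
  have hsize := h.sum_descent_dotProduct_self_le hℓ₀ hkc hconn hm hv
  rw [hform] at henergy hstep hsize
  rw [← hv] at henergy
  obtain ⟨u, hu, hle⟩ := h.exists_extension_energy_le hℓ hconn (v := v) (m := m) (φ := φ) (hv ▸ rfl)
  refine ⟨u, hu, hle.trans ?_⟩
  rw [Finset.sum_add_distrib, ← Finset.mul_sum, ← Finset.mul_sum]
  calc _ ≤ 144 * M ^ 3 * (3 * M * Q) + 288 * M ^ 3 * (3 * M * Q) +
        108 * M ^ 2 * (2 * (Q / 3) + 8 / (ℓ : ℝ) ^ 2 * (2 * c * ℓ ^ 2 * M * Q)) := by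
        gcongr
        exact h.energy_boundary_le_sqrt_form hℓ₀ φ
    _ = (1296 * M ^ 4 + 72 * M ^ 2 + 1728 * c * M ^ 3) * Q := by
        field_simp
        ring
    _ ≤ (1296 * M ^ 4 + 72 * M ^ 4 + 1728 * c * M ^ 4) * Q := by
        gcongr <;> first | exact hM | norm_num
    _ = _ := by ring

end IsLabelling

/-! ### Connected pieces of the boundary face -/

theorem ThreeConnected.connected {V : Type*} {G : SimpleGraph V} (hG : ThreeConnected G) :
    G.Connected := by
  have huniv : {v : V | v ∉ (∅ : Finset V)} = Set.univ := by simp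
  exact (induceUnivIso G).connected_iff.1 (huniv ▸ hG ∅ (Nat.zero_le _))

/-- The vertices in row `0` whose column is `i + n` modulo `k` for some `a ≤ n < b`. -/
def strip {V : Type*} {k : ℕ} (col : V → Fin k) (row : V → ℕ) (i : Fin k) (a b : ℕ) : Set V :=
  {p | row p = 0 ∧ ((col p - i : Fin k) : ℕ) ∈ Set.Ico a b}

theorem val_sub_eq_iff {k n : ℕ} [NeZero k] {i x : Fin k} (hn : n < k) :
    ((x - i : Fin k) : ℕ) = n ↔ x = i + Fin.ofNat k n := by
  rw [← sub_eq_iff_eq_add', Fin.ext_iff, Fin.val_ofNat, Nat.mod_eq_of_lt hn]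

theorem strip_succ {V : Type*} {k a b : ℕ} [NeZero k] (col : V → Fin k) (row : V → ℕ) (i : Fin k)
    (hab : a ≤ b) (hb : b < k) :
    strip col row i a (b + 1) = strip col row i a b ∪ cell col row (i + Fin.ofNat k b) 0 := by
  ext p
  simp only [strip, cell, Set.mem_ofPred_eq, Set.mem_union, Set.mem_Ico, ← val_sub_eq_iff hb]
  omega

theorem disjoint_strip {V : Type*} {k : ℕ} (col : V → Fin k) (row : V → ℕ) (i : Fin k) (a b c : ℕ) :
    Disjoint (strip col row i a b) (strip col row i b c) :=
  Set.disjoint_left.2 fun _ hp hp' => hp.2.2.not_ge hp'.2.1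

namespace IsLabelling

variable {V : Type*} {G : SimpleGraph V} {Γ : Set V} {k ℓ M : ℕ} [NeZero k]
  {col : V → Fin k} {row : V → ℕ} (h : IsLabelling G Γ k ℓ M col row)
include h

theorem nonempty_boundary : Γ.Nonempty :=
  let ⟨p, hp, _⟩ := h.boundary_col 0
  ⟨p, hp⟩

theorem preconnected_strip (hℓ : 0 < ℓ) (i : Fin k) {a b : ℕ} (hab : a < b) (hb : b ≤ k) :
    (G.induce (strip col row i a b)).Preconnected := by
  induction b, hab using Nat.le_induction with
  | base =>
    rw [strip_succ col row i le_rfl hb,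
      show strip col row i a a = ∅ by simp [strip], Set.empty_union]
    exact (h.connected _ _ hℓ).preconnected
  | succ b hab ih =>
    rw [strip_succ col row i (Nat.le_of_lt hab) hb]
    obtain ⟨n, rfl⟩ : ∃ n, b = n + 1 := ⟨b - 1, by omega⟩
    obtain ⟨p, ⟨hcol, hrow⟩, q, hq, hpq⟩ := h.horizontal (i + Fin.ofNat k n) 0 hℓ
    have hp : p ∈ strip col row i a (n + 1) :=
      ⟨hrow, by rw [(val_sub_eq_iff (by omega)).2 hcol]; exact ⟨by omega, by omega⟩⟩
    have hnext : i + Fin.ofNat k n + 1 = i + Fin.ofNat k (n + 1) := by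
      rw [add_assoc]
      congr 1
      ext
      simp [Fin.val_add]
    rw [hnext] at hq
    exact (connected_induce_union (ih (by omega)) (h.connected _ _ hℓ).preconnected hp hq
      hpq).preconnected

theorem preconnected_window [Finite V] (hℓ : 0 < ℓ) (hk : 3 ≤ k) (hG : G.Preconnected)
    {R : RotationSystem G} (hR : R.IsPlanar) {d : G.Dart} (hΓ : Γ = R.faceVertices d) (i : Fin k) :
    ((G.induce Γ).induce (window Γ col i)).Preconnected := by
  have hwindow : window Γ col i = {p : Γ | (p : V) ∈ strip col row i 0 2} := by
    ext p
    have hzero : ((col p - i : Fin k) : ℕ) = 0 ↔ col p = i := by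
      rw [val_sub_eq_iff (by omega), Fin.ofNat_zero, add_zero]
    have hone : ((col p - i : Fin k) : ℕ) = 1 ↔ col p = i + 1 := val_sub_eq_iff (by omega)
    simp only [window, strip, Set.mem_ofPred_eq, h.boundary_row p p.2, true_and, Set.mem_Ico,
      ← hzero, ← hone]
    omega
  have hcover : Γ ⊆ strip col row i 0 2 ∪ strip col row i 2 k := by
    intro p hp
    have hrow := h.boundary_row p hp
    have hcol := (col p - i).2
    simp only [strip, Set.mem_union, Set.mem_ofPred_eq, Set.mem_Ico]
    omega
  subst hΓ
  rw [hwindow]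
  have hface := R.preconnected_faceVertices_inter hG hR
    (h.preconnected_strip hℓ i two_pos (by omega)) (h.preconnected_strip hℓ i (by omega) le_rfl)
    (disjoint_strip col row i 0 2 k) hcover
  let f : G.induce (R.faceVertices d ∩ strip col row i 0 2) →g
      (G.induce (R.faceVertices d)).induce {p : R.faceVertices d | (p : V) ∈ strip col row i 0 2} :=
    ⟨fun p => ⟨⟨p, p.2.1⟩, p.2.2⟩, id⟩
  exact fun p q => (hface ⟨p, p.1.2, p.2⟩ ⟨q, q.1.2, q.2⟩).map f

end IsLabelling

/-! ### Comparison of the quadratic forms -/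

theorem le_div_inv_two_pi_sub {A : ℝ} (hA : 0 ≤ A) :
    6 * A ≤ A / (1 / (2 * Real.pi) - Real.sqrt 2 / 12) := by
  have hpi_lower : 0.158 < 1 / (2 * Real.pi) := by
    rw [lt_div_iff₀ (by positivity)]
    linarith [Real.pi_lt_d2]
  have hpi_upper : 1 / (2 * Real.pi) ≤ 1 / 6 :=
    one_div_le_one_div_of_le (by norm_num) (by linarith [Real.pi_gt_three])
  have hsqrt : Real.sqrt 2 < 1.415 := (Real.sqrt_lt' (by norm_num)).2 (by norm_num)
  rw [le_div_iff₀ (by linarith)]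
  nlinarith [Real.sqrt_nonneg 2]

theorem mul_pow_three_le_mul_max {c M : ℝ} (hM : 0 ≤ M) :
    (10 + 8 * c) * M ^ 3 ≤ 36 * M ^ 2 * (M + 3) * max (3 * c) (4 * Real.pi ^ 2) *
      (2 / (3 * Real.pi) + Real.sqrt 2 / 27) := by
  have hsqrt : 1.4 ≤ Real.sqrt 2 := Real.le_sqrt_of_sq_le (by norm_num)
  have hpi : 0.2 ≤ 2 / (3 * Real.pi) := by
    rw [le_div_iff₀ (by positivity)]
    linarith [Real.pi_lt_d2]
  have hquarter : 1 / 4 ≤ 2 / (3 * Real.pi) + Real.sqrt 2 / 27 := by linarith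
  have hmax_c := le_max_left (3 * c) (4 * Real.pi ^ 2)
  have hmax_pi : 36 ≤ max (3 * c) (4 * Real.pi ^ 2) :=
    le_max_of_le_right (by nlinarith [Real.pi_gt_three])
  set m := max (3 * c) (4 * Real.pi ^ 2)
  calc (10 + 8 * c) * M ^ 3 ≤ (9 * m) * M ^ 3 := by
        gcongr
        linarith
    _ = 36 * M ^ 2 * M * m * (1 / 4) := by ring
    _ ≤ _ := by
        gcongr
        linarith

theorem quadForm_sqrtBoundaryLaplacian_nonneg {V : Type*} [Fintype V] (G : SimpleGraph V)
    (Γ : Set V) (φ : Γ → ℝ) : 0 ≤ quadForm (sqrtBoundaryLaplacian G Γ) φ :=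
  mulVec_dotProduct_self_nonneg (posSemidef_cfc_sqrt _) φ

theorem quadForm_schurComplement_nonneg {V : Type*} [Fintype V] {G : SimpleGraph V} {Γ : Set V}
    (hG : G.Preconnected) (hΓ : Γ.Nonempty) (φ : Γ → ℝ) :
    0 ≤ quadForm (schurComplement G Γ) φ := by
  obtain ⟨u, -, hu⟩ := exists_energy_eq_quadForm_schurComplement hG hΓ φ
  exact hu ▸ energy_nonneg G u

namespace IsLabelling

variable {V : Type*} [Fintype V] {G : SimpleGraph V} {Γ : Set V} {k ℓ c M : ℕ} [NeZero k]
  {col : V → Fin k} {row : V → ℕ}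

theorem quadForm_sqrtBoundaryLaplacian_le (h : IsLabelling G Γ k ℓ M col row)
    (hG : G.Preconnected) (hℓ : 0 < ℓ) (hkc : k ≤ 2 * c * ℓ) (φ : Γ → ℝ) :
    quadForm (sqrtBoundaryLaplacian G Γ) φ ≤
      (10 + 8 * c) * M ^ 3 * quadForm (schurComplement G Γ) φ := by
  obtain ⟨u, rfl, hu⟩ := exists_energy_eq_quadForm_schurComplement hG h.nonempty_boundary φ
  exact hu ▸ h.sqrt_form_le_energy hℓ hkc u

theorem quadForm_schurComplement_le (h : IsLabelling G Γ k ℓ M col row) (hG : G.Preconnected)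
    (hℓ : 2 ≤ ℓ) (hkc : k ≤ 2 * c * ℓ)
    (hconn : ∀ i, ((G.induce Γ).induce (window Γ col i)).Preconnected) (φ : Γ → ℝ) :
    quadForm (schurComplement G Γ) φ ≤
      72 * (24 * c + 19) * M ^ 4 * quadForm (sqrtBoundaryLaplacian G Γ) φ := by
  obtain ⟨u, rfl, hu⟩ := h.exists_extension_energy_le_sqrt_form hℓ hkc hconn φ
  exact (quadForm_schurComplement_le_energy hG h.nonempty_boundary u).trans hu

end IsLabelling

end GraphTrace

open GraphTrace in
theorem theorem3p5_general {V : Type*} [Fintype V] {G : SimpleGraph V} (hG : G.Preconnected)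
    {R : RotationSystem G} (hR : R.IsPlanar) {d : G.Dart} {Γ : Set V} (hΓ : Γ = R.faceVertices d)
    {k ℓ c M : ℕ} (hℓ : 2 ≤ ℓ) (hk : 3 ≤ k) (hkc : k ≤ 2 * c * ℓ)
    {H : SimpleGraph (Fin k × Fin ℓ)} (hH₁ : annulus k ℓ ≤ H) (hH₂ : H ≤ annulusStar k ℓ)
    (hagg : IsAggregation M G Γ H) (φ : Γ → ℝ) :
    1 / (36 * (M : ℝ) ^ 2 * ((M : ℝ) + 3) * max (3 * (c : ℝ)) (4 * Real.pi ^ 2) *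
          (2 / (3 * Real.pi) + Real.sqrt 2 / 27)) *
        quadForm (sqrtBoundaryLaplacian G Γ) φ
      ≤ quadForm (schurComplement G Γ) φ ∧
    quadForm (schurComplement G Γ) φ
      ≤ 784 * (M : ℝ) ^ 4 * (3 * (c : ℝ) + 20) / (1 / (2 * Real.pi) - Real.sqrt 2 / 12) *
        quadForm (sqrtBoundaryLaplacian G Γ) φ := by
  have hℓ₀ : 0 < ℓ := by omega
  have : NeZero k := ⟨by omega⟩
  obtain ⟨aStar, a, ha⟩ := hagg
  have h := ha.isLabelling (by omega) hℓ₀ hH₁ hH₂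
  have hwindow := h.preconnected_window hℓ₀ hk hG hR hΓ
  have hM : (0 : ℝ) < M := mod_cast h.one_le hℓ₀
  constructor
  · have hconst := mul_pow_three_le_mul_max (c := c) hM.le
    rw [one_div_mul_eq_div, div_le_iff₀' (lt_of_lt_of_le (by positivity) hconst)]
    exact (h.quadForm_sqrtBoundaryLaplacian_le hG hℓ₀ hkc φ).trans
      (mul_le_mul_of_nonneg_right hconst
        (quadForm_schurComplement_nonneg hG h.nonempty_boundary φ))
  · refine (h.quadForm_schurComplement_le hG hℓ hkc hwindow φ).trans
      (mul_le_mul_of_nonneg_right ?_ (quadForm_sqrtBoundaryLaplacian_nonneg G Γ φ))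
    refine le_trans ?_ (le_div_inv_two_pi_sub (by positivity))
    calc (72 * (24 * c + 19) * M ^ 4 : ℝ) = (1728 * c + 1368) * M ^ 4 := by ring
      _ ≤ (14112 * c + 94080) * M ^ 4 := by gcongr <;> norm_num
      _ = 6 * (784 * M ^ 4 * (3 * c + 20)) := by ring

theorem theorem3p5 {V : Type*} [Fintype V] (G : SimpleGraph V) (Γ : Set V)
    (hG : GraphTrace.IsPlanarPair G Γ)
    (k ℓ c M : ℕ) (hℓ : 2 ≤ ℓ) (hk : 4 * ℓ < k) (hkc : k < 2 * c * ℓ)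
    (H : SimpleGraph (Fin k × Fin ℓ))
    (hH₁ : GraphTrace.annulus k ℓ ≤ H) (hH₂ : H ≤ GraphTrace.annulusStar k ℓ)
    (hagg : GraphTrace.IsAggregation M G Γ H) (φ : Γ → ℝ) :
    1 / (36 * (M : ℝ) ^ 2 * ((M : ℝ) + 3) * max (3 * (c : ℝ)) (4 * Real.pi ^ 2) *
          (2 / (3 * Real.pi) + Real.sqrt 2 / 27)) *
        GraphTrace.quadForm (GraphTrace.sqrtBoundaryLaplacian G Γ) φ
      ≤ GraphTrace.quadForm (GraphTrace.schurComplement G Γ) φ ∧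
    GraphTrace.quadForm (GraphTrace.schurComplement G Γ) φ
      ≤ 784 * (M : ℝ) ^ 4 * (3 * (c : ℝ) + 20) / (1 / (2 * Real.pi) - Real.sqrt 2 / 12) *
        GraphTrace.quadForm (GraphTrace.sqrtBoundaryLaplacian G Γ) φ := by
  obtain ⟨R, hR, d, hd⟩ := hG.exists_face
  exact theorem3p5_general hG.threeConnected.connected.preconnected hR hd hℓ (by omega) hkc.le
    hH₁ hH₂ hagg φ
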